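/- **Theorem 1 (Universal Navier-slip limit).** Let $n\ge 0$ and let $M^n\subset\mathbb R^{n+1}$ be a smooth embedded orientable hypersurface with smooth unit normal field $N$ and induced metric $g$. In a chart $(x^1,\dots,x^n)$ of $M$, with parametrization $X$, use the Fermi coordinates $\Phi(r,x)=X(x)+rN(x)$ and write an ambient vector field as $V=V^r\partial_r\Phi+V^i\partial_i\Phi$. Let $\Delta_B^{(n+1)}$ be the Bochner Laplacian of flat $\mathbb R^{n+1}$ (the componentwise Euclidean Laplacian), $\Delta_B^{(n)}=g^{jk}\nabla_j\nabla_k$ the Bochner Laplacian of the Levi-Civita connection of $(M,g)$, $\mathrm{Ric}^{(n)}$ its Ricci tensor, and $\Delta_{\mathrm{Def}}^{(n)}=\Delta_B^{(n)}+\mathrm{Ric}^{(n)}$ the deformation Laplacian. A field $U$ is called stress-free (Navier slip) at a point of a hypersurface with unit normal $\nu$ if $(\mathrm{Def}\,U)(\nu,v)=\tfrac12\big(\langle\bar\nabla_\nu U,v\rangle+\langle\bar\nabla_vU,\nu\rangle\big)=0$ for all $v\perp\nu$. Then in every chart of $M$ the following hold. 1. Let $U$ be an ambient vector field that is differentiable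 at the points of $M$ and tangential to $M$ on $M$. At each point of $M$ covered by the chart, $U$ is stress-free (with respect to $N$) if and only if $\partial_rU^i|_{r=0}=0$ for all $i$. 2. Let $U$ be of class $C^2$ near $M$ and tangential to $M$ on $M$, and let $x$ be such that the condition $\partial_rU^i(r,x)=0$ holds for all $i$ and all $r$ near $0$. Then at $r=0$ and this $x$ $$(\Delta_B^{(n+1)}U)^i=\Delta_B^{(n)}U^i+\mathrm{Ric}^{(n)\,i}{}_l\,U^l .$$ 3. (Thin-shell limit.) For small $\varepsilon>0$ let $W_\varepsilon$ be a $C^2$ vector field on the shell $\{p+rN(p):p\in M,\ |r|\le\varepsilon/2\}$ that is tangential and stress-free on both walls $r=\pm\varepsilon/2$ (near each point of $M$, for all sufficiently small $\varepsilon$). Suppose that as $\varepsilon\to0^+$ the fields $W_\varepsilon$ converge, with their derivatives of order at most two and locally uniformly over the shells, to a vector field $U$ of class $C^2$ near $M$; that is, for $k\le 2$ and $p_0\in M$, $D^kW_\varepsilon(p+rN(p))\to D^kU(p_0)$ as $\varepsilon\to0^+$, $p\to p_0$, $|r|\le\varepsilon/2$. Then $U$ is tangential to $M$ on $M$, and,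 with $u=U|_M$, $$(\Delta_B^{(n+1)}W_\varepsilon)^i(r,x)\longrightarrow\big(\Delta_B^{(n)}u+\mathrm{Ric}^{(n)}u\big)^i(x_0)\qquad(\varepsilon\to0^+,\ |r|\le\varepsilon/2,\ x\to x_0)$$ for every point $x_0$ of the chart. Thus the limit operator is the deformation Laplacian, which depends only on the induced metric $g$ and not on the shape operator of $M$. -/

import Mathlib

open Set Filter Topology Manifold
open scoped ContDiff InnerProductSpace

noncomputable section

namespace ThinShell

/-! ### Riemannian geometry of a metric `g` in coordinates

`g x i j` are the components `g_{ij}(x)` of a metric in a chart with values in `ℝⁿ`, and `u x i` are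
the contravariant components `u^i(x)` of a vector field in that chart. -/

section Coordinates

variable {n : ℕ}

/-- The partial derivative `∂_i f (x)`. -/
def partialDeriv (i : Fin n) (f : EuclideanSpace ℝ (Fin n) → ℝ) (x : EuclideanSpace ℝ (Fin n)) :
    ℝ :=
  fderiv ℝ f x (EuclideanSpace.single i 1)

/-- The Christoffel symbols of the Levi-Civita connection,
`Γ^i_{jk} = ½ g^{il} (∂_j g_{kl} + ∂_k g_{jl} - ∂_l g_{jk})`. -/
def christoffel (g : EuclideanSpace ℝ (Fin n) → Matrix (Fin n) (Fin n) ℝ) (i j k : Fin n)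
    (x : EuclideanSpace ℝ (Fin n)) : ℝ :=
  (1 / 2) * ∑ l, (g x)⁻¹ i l *
    (partialDeriv j (fun y => g y k l) x + partialDeriv k (fun y => g y j l) x
      - partialDeriv l (fun y => g y j k) x)

/-- The Riemann curvature tensor, `R(∂_i, ∂_j) ∂_k = R^l_{kij} ∂_l` with
`R^l_{kij} = ∂_i Γ^l_{jk} - ∂_j Γ^l_{ik} + Γ^l_{im} Γ^m_{jk} - Γ^l_{jm} Γ^m_{ik}`. -/
def riemann (g : EuclideanSpace ℝ (Fin n) → Matrix (Fin n) (Fin n) ℝ) (l k i j : Fin n)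
    (x : EuclideanSpace ℝ (Fin n)) : ℝ :=
  partialDeriv i (christoffel g l j k) x - partialDeriv j (christoffel g l i k) x
    + ∑ m, (christoffel g l i m x * christoffel g m j k x
      - christoffel g l j m x * christoffel g m i k x)

/-- The Ricci tensor `Ric_{jk} = R^i_{kij}` (positive on round spheres). -/
def ricci (g : EuclideanSpace ℝ (Fin n) → Matrix (Fin n) (Fin n) ℝ) (j k : Fin n)
    (x : EuclideanSpace ℝ (Fin n)) : ℝ :=
  ∑ i, riemann g i k i j x

/-- The Ricci tensor with one index raised, `Ric^i_l = g^{ij} Ric_{jl}`. -/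
def ricciEndo (g : EuclideanSpace ℝ (Fin n) → Matrix (Fin n) (Fin n) ℝ) (i l : Fin n)
    (x : EuclideanSpace ℝ (Fin n)) : ℝ :=
  ∑ j, (g x)⁻¹ i j * ricci g j l x

/-- The covariant derivative `∇_k u^i = ∂_k u^i + Γ^i_{kl} u^l`. -/
def covDeriv (g : EuclideanSpace ℝ (Fin n) → Matrix (Fin n) (Fin n) ℝ)
    (u : EuclideanSpace ℝ (Fin n) → EuclideanSpace ℝ (Fin n)) (k i : Fin n)
    (x : EuclideanSpace ℝ (Fin n)) : ℝ :=
  partialDeriv k (fun y => u y i) x + ∑ l, christoffel g i k l x * u x l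

/-- The second covariant derivative
`∇_j ∇_k u^i = ∂_j (∇_k u^i) + Γ^i_{jl} ∇_k u^l - Γ^l_{jk} ∇_l u^i`. -/
def covDeriv₂ (g : EuclideanSpace ℝ (Fin n) → Matrix (Fin n) (Fin n) ℝ)
    (u : EuclideanSpace ℝ (Fin n) → EuclideanSpace ℝ (Fin n)) (j k i : Fin n)
    (x : EuclideanSpace ℝ (Fin n)) : ℝ :=
  partialDeriv j (covDeriv g u k i) x
    + ∑ l, (christoffel g i j l x * covDeriv g u k l x
      - christoffel g l j k x * covDeriv g u l i x)

/-- The Bochner Laplacian `(Δ_B u)^i = g^{jk} ∇_j ∇_k u^i`. -/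
def bochnerLaplacian (g : EuclideanSpace ℝ (Fin n) → Matrix (Fin n) (Fin n) ℝ)
    (u : EuclideanSpace ℝ (Fin n) → EuclideanSpace ℝ (Fin n)) (i : Fin n)
    (x : EuclideanSpace ℝ (Fin n)) : ℝ :=
  ∑ j, ∑ k, (g x)⁻¹ j k * covDeriv₂ g u j k i x

/-- The deformation Laplacian `(Δ_Def u)^i = (Δ_B u)^i + Ric^i_l u^l`. -/
def deformationLaplacian (g : EuclideanSpace ℝ (Fin n) → Matrix (Fin n) (Fin n) ℝ)
    (u : EuclideanSpace ℝ (Fin n) → EuclideanSpace ℝ (Fin n)) (i : Fin n)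
    (x : EuclideanSpace ℝ (Fin n)) : ℝ :=
  bochnerLaplacian g u i x + ∑ l, ricciEndo g i l x * u x l

end Coordinates

/-! ### Hypersurfaces and Fermi coordinates -/

section Hypersurface

variable {n : ℕ} {M : Type*} [TopologicalSpace M] [ChartedSpace (EuclideanSpace ℝ (Fin n)) M]

/-- `N` is a smooth unit normal field along `ι : M → ℝⁿ⁺¹`. -/
structure IsUnitNormal (ι N : M → EuclideanSpace ℝ (Fin (n + 1))) : Prop where
  smooth : ContMDiff (𝓡 n) (𝓡 (n + 1)) ∞ N
  norm_eq_one : ∀ p, ‖N p‖ = 1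
  orthogonal : ∀ (p : M) (v : TangentSpace (𝓡 n) p),
    ⟪N p, (mfderiv (𝓡 n) (𝓡 (n + 1)) ι p v : EuclideanSpace ℝ (Fin (n + 1)))⟫_ℝ = 0

/-- The point of `ℝⁿ⁺¹` at signed normal distance `r` from the point `p` of the hypersurface. -/
def normalShift (ι N : M → EuclideanSpace ℝ (Fin (n + 1))) (r : ℝ) (p : M) :
    EuclideanSpace ℝ (Fin (n + 1)) :=
  ι p + r • N p

/-- The components `g_{ij} = ⟪∂_i X, ∂_j X⟫` of the induced metric in the chart `φ`, where
`X = ι ∘ φ⁻¹` is the corresponding local parametrization of the hypersurface. -/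
def inducedMetric (ι : M → EuclideanSpace ℝ (Fin (n + 1)))
    (φ : OpenPartialHomeomorph M (EuclideanSpace ℝ (Fin n))) (x : EuclideanSpace ℝ (Fin n)) :
    Matrix (Fin n) (Fin n) ℝ :=
  Matrix.of fun i j =>
    ⟪fderiv ℝ (fun y => ι (φ.symm y)) x (EuclideanSpace.single i 1),
      fderiv ℝ (fun y => ι (φ.symm y)) x (EuclideanSpace.single j 1)⟫_ℝ

/-- The Fermi parametrization `Φ(r, x) = X(x) + r N(x)` of a neighbourhood of the hypersurface
associated with the chart `φ`. -/
def fermiMap (ι N : M → EuclideanSpace ℝ (Fin (n + 1)))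
    (φ : OpenPartialHomeomorph M (EuclideanSpace ℝ (Fin n)))
    (y : ℝ × EuclideanSpace ℝ (Fin n)) : EuclideanSpace ℝ (Fin (n + 1)) :=
  normalShift ι N y.1 (φ.symm y.2)

/-- The tangential contravariant components `V^i(r, x)` of an ambient vector field `V` in the Fermi
coordinates `(r, x)`: `V(Φ(r, x)) = V^r ∂_r Φ + V^i ∂_i Φ`, that is `(V^r, V^i) = DΦ(r, x)⁻¹ V`. -/
def fermiComp (ι N : M → EuclideanSpace ℝ (Fin (n + 1)))
    (φ : OpenPartialHomeomorph M (EuclideanSpace ℝ (Fin n)))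
    (V : EuclideanSpace ℝ (Fin (n + 1)) → EuclideanSpace ℝ (Fin (n + 1)))
    (r : ℝ) (x : EuclideanSpace ℝ (Fin n)) : EuclideanSpace ℝ (Fin n) :=
  (VectorField.pullback ℝ (fermiMap ι N φ) V (r, x)).2

end Hypersurface

/-! ### Boundary conditions -/

section BoundaryConditions

variable {E : Type*} [NormedAddCommGroup E] [InnerProductSpace ℝ E]

/-- The deformation tensor of a vector field on a flat space,
`(Def U)(v, w) = ½ (⟪∇_v U, w⟫ + ⟪∇_w U, v⟫)`. -/
def deformation (U : E → E) (y v w : E) : ℝ :=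
  (1 / 2) * (⟪fderiv ℝ U y v, w⟫_ℝ + ⟪fderiv ℝ U y w, v⟫_ℝ)

/-- The Navier-slip (stress-free) condition at a point `y` of a hypersurface with unit normal `ν`
at `y`: the normal-tangential part of the deformation tensor vanishes. -/
def StressFreeAt (U : E → E) (y ν : E) : Prop :=
  ∀ v : E, ⟪v, ν⟫_ℝ = 0 → deformation U y ν v = 0

/-- The field `U` is tangential at a point `y` of a hypersurface with unit normal `ν` at `y`. -/
def TangentialAt (U : E → E) (y ν : E) : Prop :=
  ⟪U y, ν⟫_ℝ = 0

end BoundaryConditions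

/-- The filter of triples `(ε, r, p)` with `ε → 0⁺`, `|r| ≤ ε / 2` and `p → p₀`: the points with
Fermi coordinates `(r, p)` in shells of thickness `ε → 0`, near the point `p₀`. -/
def shellFilter {P : Type*} [TopologicalSpace P] (p₀ : P) : Filter (ℝ × ℝ × P) :=
  (𝓝[>] (0 : ℝ) ×ˢ 𝓝 (0 : ℝ) ×ˢ 𝓝 p₀) ⊓ 𝓟 {q | |q.2.1| ≤ q.1 / 2}

end ThinShell

end

/-! Write `T = DΦ(r, x)`, so `T (a, v) = a ν + dX v + r dν v`, and express a field as `U = T c`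
along a normal line. The `r`-derivative of the frame is `dν` acting on the tangential slot. Hence
`∂_ν U = T c' + dν c.2`, and differentiating again, `∂_ν ∂_ν U = T c'' + 2 dν c'.2`.

Slip condition: on a parallel surface to which `U` is tangential, differentiating `⟪U, ν⟫ = 0` gives
`⟪∇_v U, ν⟫ = -⟪U, dν v⟫`. Because the shape operator is symmetric, this cancels the `dν c.2` part
of `∂_ν U`. What remains of the normal-tangential stress is half the inner product of `T (0, c'.2)`
with `v`, so the condition is `c'.2 = 0`. The normal component `c'.1` never enters.

Laplacian: let `S = g⁻¹ K` be the shape operator, where `K` is the second fundamental form. If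
`c'.2` and `c''.2` vanish at `r = 0`, then `∂_ν ∂_ν U` has no tangential part and the tangential
part of `∂_ν U` is `-S u`. Decomposing the second derivatives of `U ∘ X` by the Gauss and Weingarten
formulas gives `Δ_B u` plus `(tr S) S u - S² u`. The Gauss equation says that this last term is `Ric
u`, so the extrinsic terms combine into an intrinsic one (`IsNormalParam.tangComp_laplacian`).

Thin shell: on each wall `c'.2 = 0`, so by Rolle each component of `c''.2` has a zero between the
walls. Under `C²` convergence both facts pass to `r = 0`
(`IsNormalParam.deriv_pullback_eq_zero_of_shell`). The ambient Laplacians converge as well, which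
reduces the limit to the previous case. -/

section NormalParam

/-! ### Fermi coordinates: the moving frame, normal derivatives and the slip condition. -/

variable {E F : Type*} [NormedAddCommGroup E] [NormedSpace ℝ E]
  [NormedAddCommGroup F] [InnerProductSpace ℝ F]

/-- `X` is a smooth immersed parametrization of a hypersurface over the open set `s`, with smooth
unit normal field `ν`. -/
structure IsNormalParam (X ν : E → F) (s : Set E) : Prop where
  isOpen : IsOpen s
  contDiffOn : ContDiffOn ℝ ∞ X s
  contDiffOn_normal : ContDiffOn ℝ ∞ ν s
  norm_normal : ∀ x ∈ s, ‖ν x‖ = 1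
  orthogonal : ∀ x ∈ s, ∀ v, ⟪ν x, fderiv ℝ X x v⟫_ℝ = 0
  injective : ∀ x ∈ s, Function.Injective (fderiv ℝ X x)

/-- The Fermi parametrization of a neighbourhood of the hypersurface parametrized by `X`. -/
def tubeMap (X ν : E → F) (y : ℝ × E) : F := X y.2 + y.1 • ν y.2

theorem tubeMap_zero {E : Type*} (X ν : E → F) (x : E) : tubeMap X ν (0, x) = X x := by
  simp [tubeMap]

theorem fderiv_tubeMap_pullback {X ν : E → F} {y : ℝ × E}
    (hinv : (fderiv ℝ (tubeMap X ν) y).IsInvertible) (U : F → F) :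
    fderiv ℝ (tubeMap X ν) y (VectorField.pullback ℝ (tubeMap X ν) U y) = U (tubeMap X ν y) := by
  obtain ⟨e, he⟩ := hinv
  simp [VectorField.pullback, ← he]

namespace IsNormalParam

variable {X ν : E → F} {s : Set E} {x : E}

theorem contDiffAt (h : IsNormalParam X ν s) (hx : x ∈ s) : ContDiffAt ℝ ∞ X x :=
  h.contDiffOn.contDiffAt (h.isOpen.mem_nhds hx)

theorem contDiffAt_normal (h : IsNormalParam X ν s) (hx : x ∈ s) : ContDiffAt ℝ ∞ ν x :=
  h.contDiffOn_normal.contDiffAt (h.isOpen.mem_nhds hx)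

theorem hasFDerivAt (h : IsNormalParam X ν s) (hx : x ∈ s) : HasFDerivAt X (fderiv ℝ X x) x :=
  ((h.contDiffAt hx).differentiableAt (by simp)).hasFDerivAt

theorem hasFDerivAt_normal (h : IsNormalParam X ν s) (hx : x ∈ s) :
    HasFDerivAt ν (fderiv ℝ ν x) x :=
  ((h.contDiffAt_normal hx).differentiableAt (by simp)).hasFDerivAt

theorem contDiffAt_fderiv (h : IsNormalParam X ν s) (hx : x ∈ s) :
    ContDiffAt ℝ ∞ (fderiv ℝ X) x :=
  (h.contDiffAt hx).fderiv_right (by simp)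

theorem contDiffAt_fderiv_normal (h : IsNormalParam X ν s) (hx : x ∈ s) :
    ContDiffAt ℝ ∞ (fderiv ℝ ν) x :=
  (h.contDiffAt_normal hx).fderiv_right (by simp)

theorem eventually_mem (h : IsNormalParam X ν s) (hx : x ∈ s) : ∀ᶠ y in 𝓝 x, y ∈ s :=
  h.isOpen.mem_nhds hx

theorem inner_normal_self (h : IsNormalParam X ν s) (hx : x ∈ s) : ⟪ν x, ν x⟫_ℝ = 1 := by
  rw [real_inner_self_eq_norm_sq, h.norm_normal x hx, one_pow]

theorem inner_normal_fderiv_normal (h : IsNormalParam X ν s) (hx : x ∈ s) (v : E) :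
    ⟪ν x, fderiv ℝ ν x v⟫_ℝ = 0 := by
  have h1 := (h.hasFDerivAt_normal hx).inner ℝ (h.hasFDerivAt_normal hx)
  have h2 : HasFDerivAt (fun y => ⟪ν y, ν y⟫_ℝ) (0 : E →L[ℝ] ℝ) x :=
    (hasFDerivAt_const (1 : ℝ) x).congr_of_eventuallyEq
      ((h.eventually_mem hx).mono fun y hy => h.inner_normal_self hy)
  have h3 := DFunLike.congr_fun (h1.unique h2) v
  simp [fderivInnerCLM_apply, real_inner_comm] at h3
  linarith [real_inner_comm (ν x) (fderiv ℝ ν x v)]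

/-- Differentiate `⟪ν, dX w⟫ = 0` in the direction `v`. -/
theorem inner_normal_fderiv_fderiv (h : IsNormalParam X ν s) (hx : x ∈ s) (v w : E) :
    ⟪ν x, fderiv ℝ (fderiv ℝ X) x v w⟫_ℝ = -⟪fderiv ℝ ν x v, fderiv ℝ X x w⟫_ℝ := by
  have hd : HasFDerivAt (fderiv ℝ X) (fderiv ℝ (fderiv ℝ X) x) x :=
    ((h.contDiffAt_fderiv hx).differentiableAt (by simp)).hasFDerivAt
  have h1 := (h.hasFDerivAt_normal hx).inner ℝ (hd.clm_apply (hasFDerivAt_const w x))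
  have h2 : HasFDerivAt (fun y => ⟪ν y, fderiv ℝ X y w⟫_ℝ) (0 : E →L[ℝ] ℝ) x :=
    (hasFDerivAt_const (0 : ℝ) x).congr_of_eventuallyEq
      ((h.eventually_mem hx).mono fun y hy => h.orthogonal y hy w)
  have h3 := DFunLike.congr_fun (h1.unique h2) v
  simp [fderivInnerCLM_apply] at h3
  linarith

theorem fderiv_fderiv_symm (h : IsNormalParam X ν s) (hx : x ∈ s) (v w : E) :
    fderiv ℝ (fderiv ℝ X) x v w = fderiv ℝ (fderiv ℝ X) x w v :=
  ((h.contDiffAt hx).isSymmSndFDerivAt (by simpa using WithTop.coe_le_coe.2 (le_top (a := (2 : ℕ∞))))) v w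

/-- Symmetry of the shape operator, inherited from the symmetry of the second derivative of `X`. -/
theorem inner_fderiv_normal_symm (h : IsNormalParam X ν s) (hx : x ∈ s) (v w : E) :
    ⟪fderiv ℝ ν x v, fderiv ℝ X x w⟫_ℝ = ⟪fderiv ℝ ν x w, fderiv ℝ X x v⟫_ℝ := by
  have h1 := h.inner_normal_fderiv_fderiv hx v w
  have h2 := h.inner_normal_fderiv_fderiv hx w v
  rw [h.fderiv_fderiv_symm hx] at h1
  linarith

theorem contDiffAt_tubeMap (h : IsNormalParam X ν s) (hx : x ∈ s) (r : ℝ) :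
    ContDiffAt ℝ ∞ (tubeMap X ν) (r, x) :=
  ((h.contDiffAt hx).comp (r, x) contDiffAt_snd).add
    (contDiffAt_fst.smul ((h.contDiffAt_normal hx).comp (r, x) contDiffAt_snd))

theorem contDiffAt_fderiv_tubeMap (h : IsNormalParam X ν s) (hx : x ∈ s) (r : ℝ) :
    ContDiffAt ℝ ∞ (fderiv ℝ (tubeMap X ν)) (r, x) :=
  (h.contDiffAt_tubeMap hx r).fderiv_right (by simp)

theorem fderiv_tubeMap_apply (h : IsNormalParam X ν s) (hx : x ∈ s) (r : ℝ) (w : ℝ × E) :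
    fderiv ℝ (tubeMap X ν) (r, x) w =
      w.1 • ν x + (fderiv ℝ X x w.2 + r • fderiv ℝ ν x w.2) := by
  have hX : HasFDerivAt (fun y : ℝ × E => X y.2) _ (r, x) :=
    (h.hasFDerivAt hx).comp (r, x) (hasFDerivAt_snd (𝕜 := ℝ) (E := ℝ) (F := E))
  have hν : HasFDerivAt (fun y : ℝ × E => ν y.2) _ (r, x) :=
    (h.hasFDerivAt_normal hx).comp (r, x) (hasFDerivAt_snd (𝕜 := ℝ) (E := ℝ) (F := E))
  have := (hX.add ((hasFDerivAt_fst (𝕜 := ℝ) (E := ℝ) (F := E)).smul hν)).fderiv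
  rw [show tubeMap X ν = (fun y : ℝ × E => X y.2) + fun y : ℝ × E => y.1 • ν y.2 from rfl]
  erw [this]
  simp
  abel

theorem inner_normal_fderiv_tubeMap (h : IsNormalParam X ν s) (hx : x ∈ s) (r : ℝ) (w : ℝ × E) :
    ⟪ν x, fderiv ℝ (tubeMap X ν) (r, x) w⟫_ℝ = w.1 := by
  rw [h.fderiv_tubeMap_apply hx, inner_add_right, inner_add_right, inner_smul_right,
    inner_smul_right, h.inner_normal_self hx, h.orthogonal x hx,
    h.inner_normal_fderiv_normal hx]
  ring

theorem _root_.hasDerivAt_tubeMap {E : Type*} (X ν : E → F) (r : ℝ) (x : E) :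
    HasDerivAt (fun t => tubeMap X ν (t, x)) (ν x) r := by
  have := ((hasDerivAt_id r).smul_const (ν x)).const_add (X x)
  rw [one_smul] at this
  exact this

/-- On the kernel, pairing with `ν` kills the first slot and the immersion property kills the
second; equality of dimensions turns injectivity into invertibility. -/
theorem isInvertible_fderiv_tubeMap [FiniteDimensional ℝ E] [FiniteDimensional ℝ F]
    (h : IsNormalParam X ν s) (hx : x ∈ s) (hd : Module.finrank ℝ F = Module.finrank ℝ E + 1) :
    (fderiv ℝ (tubeMap X ν) (0, x)).IsInvertible := by
  have hinj : Function.Injective (fderiv ℝ (tubeMap X ν) (0, x)).toLinearMap := by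
    rw [← LinearMap.ker_eq_bot, LinearMap.ker_eq_bot']
    intro w hw
    have hw' : fderiv ℝ (tubeMap X ν) (0, x) w = 0 := hw
    have h1 : w.1 = 0 := by
      rw [← h.inner_normal_fderiv_tubeMap hx 0 w, hw', inner_zero_right]
    rw [h.fderiv_tubeMap_apply hx, h1] at hw'
    have h2 : w.2 = 0 := h.injective x hx (by simpa using hw')
    exact Prod.ext h1 h2
  have hfr : Module.finrank ℝ (ℝ × E) = Module.finrank ℝ F := by
    rw [Module.finrank_prod, hd, Module.finrank_self, add_comm]
  exact ⟨(LinearEquiv.ofInjectiveOfFinrankEq _ hinj hfr).toContinuousLinearEquiv, by ext <;> rfl⟩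

theorem eventually_isInvertible [FiniteDimensional ℝ E] [FiniteDimensional ℝ F]
    (h : IsNormalParam X ν s) (hx : x ∈ s) {r : ℝ}
    (hinv : (fderiv ℝ (tubeMap X ν) (r, x)).IsInvertible) :
    ∀ᶠ y in 𝓝 (r, x), (fderiv ℝ (tubeMap X ν) y).IsInvertible := by
  obtain ⟨e, he⟩ := hinv
  have := (h.contDiffAt_fderiv_tubeMap hx r).continuousAt
  have := this (he ▸ ContinuousLinearEquiv.nhds e)
  filter_upwards [this] with y hy
  exact hy

theorem contDiffAt_inverse [FiniteDimensional ℝ E]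
    (h : IsNormalParam X ν s) (hx : x ∈ s) {r : ℝ}
    (hinv : (fderiv ℝ (tubeMap X ν) (r, x)).IsInvertible) :
    ContDiffAt ℝ ∞ (fun y => (fderiv ℝ (tubeMap X ν) y).inverse) (r, x) :=
  have : CompleteSpace E := FiniteDimensional.complete ℝ E
  hinv.contDiffAt_map_inverse.comp (r, x) (h.contDiffAt_fderiv_tubeMap hx r)

theorem contDiffAt_pullback [FiniteDimensional ℝ E]
    (h : IsNormalParam X ν s) (hx : x ∈ s) {r : ℝ}
    (hinv : (fderiv ℝ (tubeMap X ν) (r, x)).IsInvertible) {U : F → F} {k : ℕ}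
    (hU : ContDiffAt ℝ k U (tubeMap X ν (r, x))) :
    ContDiffAt ℝ k (VectorField.pullback ℝ (tubeMap X ν) U) (r, x) :=
  ((h.contDiffAt_inverse hx hinv).of_le (mod_cast le_top)).clm_apply
    (hU.comp (r, x) ((h.contDiffAt_tubeMap hx r).of_le (mod_cast le_top)))

/-- The slip criterion assumes only differentiability of `U` at the point, so the `ContDiffAt`
version does not cover it. -/
theorem differentiableAt_pullback_line [FiniteDimensional ℝ E]
    (h : IsNormalParam X ν s) (hx : x ∈ s) {r : ℝ}
    (hinv : (fderiv ℝ (tubeMap X ν) (r, x)).IsInvertible) {U : F → F}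
    (hU : DifferentiableAt ℝ U (tubeMap X ν (r, x))) :
    DifferentiableAt ℝ (fun t => VectorField.pullback ℝ (tubeMap X ν) U (t, x)) r := by
  have h0 : DifferentiableAt ℝ (fun t : ℝ => (t, x)) r := by fun_prop
  have h1 : DifferentiableAt ℝ (fun t => (fderiv ℝ (tubeMap X ν) (t, x)).inverse) r :=
    DifferentiableAt.comp (g := fun y => (fderiv ℝ (tubeMap X ν) y).inverse) r
      ((h.contDiffAt_inverse hx hinv).differentiableAt (by simp)) h0
  exact h1.clm_apply (DifferentiableAt.comp (g := U) r hU
    (hasDerivAt_tubeMap X ν r x).differentiableAt)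

theorem contDiffAt_pullback_line [FiniteDimensional ℝ E]
    (h : IsNormalParam X ν s) (hx : x ∈ s) {r : ℝ}
    (hinv : (fderiv ℝ (tubeMap X ν) (r, x)).IsInvertible) {U : F → F}
    (hU : ContDiffAt ℝ 2 U (tubeMap X ν (r, x))) :
    ContDiffAt ℝ 2 (fun t => VectorField.pullback ℝ (tubeMap X ν) U (t, x)) r :=
  (h.contDiffAt_pullback hx hinv (k := 2) hU).comp r (f := fun t : ℝ => (t, x)) (by fun_prop)

/-- The derivative in the normal direction of a combination of the Fermi frame. -/
theorem hasDerivAt_fderiv_tubeMap_apply (h : IsNormalParam X ν s) (hx : x ∈ s) {r : ℝ}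
    {c : ℝ → ℝ × E} {c' : ℝ × E} (hc : HasDerivAt c c' r) :
    HasDerivAt (fun t => fderiv ℝ (tubeMap X ν) (t, x) (c t))
      (fderiv ℝ (tubeMap X ν) (r, x) c' + fderiv ℝ ν x (c r).2) r := by
  have h1 : HasDerivAt (fun t => (c t).1) c'.1 r := hc.fst
  have h2 : HasDerivAt (fun t => (c t).2) c'.2 r := hc.snd
  have := (h1.smul_const (ν x)).add (((fderiv ℝ X x).hasFDerivAt.comp_hasDerivAt r h2).add
    ((hasDerivAt_id r).smul ((fderiv ℝ ν x).hasFDerivAt.comp_hasDerivAt r h2)))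
  simp only [h.fderiv_tubeMap_apply hx]
  convert this using 1
  · rfl
  · simp only [id, one_smul, Function.comp]
    abel

/-- Product rule for `U = T c` along the normal line; the second term is the `r`-derivative of the
frame. -/
theorem fderiv_normal_eq [FiniteDimensional ℝ E] [FiniteDimensional ℝ F]
    (h : IsNormalParam X ν s) (hx : x ∈ s) {r : ℝ}
    (hinv : (fderiv ℝ (tubeMap X ν) (r, x)).IsInvertible) {U : F → F}
    (hU : DifferentiableAt ℝ U (tubeMap X ν (r, x))) :
    fderiv ℝ U (tubeMap X ν (r, x)) (ν x) = fderiv ℝ (tubeMap X ν) (r, x)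
        (deriv (fun t => VectorField.pullback ℝ (tubeMap X ν) U (t, x)) r) +
      fderiv ℝ ν x (VectorField.pullback ℝ (tubeMap X ν) U (r, x)).2 := by
  have h1 := h.hasDerivAt_fderiv_tubeMap_apply hx
    (h.differentiableAt_pullback_line hx hinv hU).hasDerivAt
  have h2 : HasDerivAt (fun t => U (tubeMap X ν (t, x))) _ r :=
    hU.hasFDerivAt.comp_hasDerivAt r (hasDerivAt_tubeMap X ν r x)
  refine h2.unique (h1.congr_of_eventuallyEq ?_)
  have h3 : Tendsto (fun t : ℝ => (t, x)) (𝓝 r) (𝓝 (r, x)) :=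
    Continuous.tendsto (by fun_prop) r
  filter_upwards [h3.eventually (h.eventually_isInvertible hx hinv)] with t ht
  exact (fderiv_tubeMap_pullback ht U).symm

/-- The first-order identity holds on a neighbourhood of `r`, so it can be differentiated. The
factor 2 collects one `dν c'.2` from the frame and one from the term `dν c.2`. -/
theorem fderiv_fderiv_normal_eq [FiniteDimensional ℝ E] [FiniteDimensional ℝ F]
    (h : IsNormalParam X ν s) (hx : x ∈ s) {r : ℝ}
    (hinv : (fderiv ℝ (tubeMap X ν) (r, x)).IsInvertible) {U : F → F}
    (hU : ContDiffAt ℝ 2 U (tubeMap X ν (r, x))) :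
    fderiv ℝ (fderiv ℝ U) (tubeMap X ν (r, x)) (ν x) (ν x) = fderiv ℝ (tubeMap X ν) (r, x)
        (deriv (deriv (fun t => VectorField.pullback ℝ (tubeMap X ν) U (t, x))) r) +
      (2 : ℝ) • fderiv ℝ ν x
        (deriv (fun t => VectorField.pullback ℝ (tubeMap X ν) U (t, x)) r).2 := by
  have hl : Tendsto (fun t : ℝ => (t, x)) (𝓝 r) (𝓝 (r, x)) :=
    Continuous.tendsto (by fun_prop) r
  have hc : ContDiffAt ℝ 2 (fun t => VectorField.pullback ℝ (tubeMap X ν) U (t, x)) r :=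
    h.contDiffAt_pullback_line hx hinv hU
  have hc' : DifferentiableAt ℝ
      (deriv (fun t => VectorField.pullback ℝ (tubeMap X ν) U (t, x))) r :=
    (hc.derivWithin (m := 1) (by norm_num)).differentiableAt (by simp)
  have hd : DifferentiableAt ℝ (fderiv ℝ U) (tubeMap X ν (r, x)) :=
    (hU.fderiv_right (m := 1) (by norm_num)).differentiableAt (by simp)
  have h2 : HasDerivAt (fun t => fderiv ℝ U (tubeMap X ν (t, x)) (ν x))
      (fderiv ℝ (fderiv ℝ U) (tubeMap X ν (r, x)) (ν x) (ν x)) r := by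
    have := HasDerivAt.clm_apply
      (HasFDerivAt.comp_hasDerivAt (f := fun t => tubeMap X ν (t, x)) r hd.hasFDerivAt
        (hasDerivAt_tubeMap X ν r x)) (hasDerivAt_const r (ν x))
    simpa using this
  have h1 := h.hasDerivAt_fderiv_tubeMap_apply hx hc'.hasDerivAt
  have h4 : HasDerivAt (fun t => fderiv ℝ ν x (VectorField.pullback ℝ (tubeMap X ν) U (t, x)).2)
      (fderiv ℝ ν x (deriv (fun t => VectorField.pullback ℝ (tubeMap X ν) U (t, x)) r).2) r :=
    (fderiv ℝ ν x).hasFDerivAt.comp_hasDerivAt r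
      (hc.differentiableAt (by simp)).hasDerivAt.snd
  have h3 := h2.unique ((h1.add h4).congr_of_eventuallyEq ?_)
  · rw [h3, two_smul, add_assoc]
  · have hU' := hl.eventually ((h.contDiffAt_tubeMap hx r).continuousAt.eventually
      (hU.eventually (by simp)))
    filter_upwards [hl.eventually (h.eventually_isInvertible hx hinv), hU'] with t ht htU
    exact h.fderiv_normal_eq hx ht (htU.differentiableAt (by simp))

/-- For fields tangential to the parallel hypersurface at distance `r`, the stress-free condition
says that the tangential Fermi components have vanishing normal derivative. -/
theorem stressFreeAt_iff [FiniteDimensional ℝ E] [FiniteDimensional ℝ F]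
    (h : IsNormalParam X ν s) (hx : x ∈ s) {r : ℝ}
    (hinv : (fderiv ℝ (tubeMap X ν) (r, x)).IsInvertible) {U : F → F}
    (hU : DifferentiableAt ℝ U (tubeMap X ν (r, x)))
    (htan : ∀ᶠ y in 𝓝 x, ThinShell.TangentialAt U (tubeMap X ν (r, y)) (ν y)) :
    ThinShell.StressFreeAt U (tubeMap X ν (r, x)) (ν x) ↔
      (deriv (fun t => VectorField.pullback ℝ (tubeMap X ν) U (t, x)) r).2 = 0 := by
  set c := fun t => VectorField.pullback ℝ (tubeMap X ν) U (t, x) with hcdef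
  set T := fderiv ℝ (tubeMap X ν) (r, x) with hT
  have hUc : U (tubeMap X ν (r, x)) = T (c r) := (fderiv_tubeMap_pullback hinv U).symm
  have hc1 : (c r).1 = 0 := by
    rw [← h.inner_normal_fderiv_tubeMap hx r (c r), ← hT, ← hUc, real_inner_comm]
    exact htan.self_of_nhds
  have hT0 : ∀ v, T (0, v) = fderiv ℝ X x v + r • fderiv ℝ ν x v := fun v => by
    rw [hT, h.fderiv_tubeMap_apply hx]; simp
  have hν := h.fderiv_normal_eq hx hinv hU
  -- The shape operator is symmetric on the parallel surface too: the additional term `r ⟪dν v, dν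
  -- w⟫` is itself symmetric.
  have hsymm : ∀ v w, ⟪fderiv ℝ ν x v, T (0, w)⟫_ℝ = ⟪fderiv ℝ ν x w, T (0, v)⟫_ℝ := by
    intro v w
    rw [hT0, hT0, inner_add_right, inner_add_right, inner_smul_right, inner_smul_right,
      h.inner_fderiv_normal_symm hx v w, real_inner_comm (fderiv ℝ ν x v) (fderiv ℝ ν x w)]
  have hdiff : ∀ v, ⟪fderiv ℝ U (tubeMap X ν (r, x)) (T (0, v)), ν x⟫_ℝ =
      -⟪T (c r), fderiv ℝ ν x v⟫_ℝ := by
    intro v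
    have hi : HasFDerivAt (fun y : E => (r, y)) (ContinuousLinearMap.inr ℝ ℝ E) x :=
      hasFDerivAt_prodMk_right r x
    have ht : HasFDerivAt (tubeMap X ν) T (r, x) :=
      ((h.contDiffAt_tubeMap hx r).differentiableAt (by simp)).hasFDerivAt
    have h1 : HasFDerivAt (fun y => U (tubeMap X ν (r, y))) _ x :=
      hU.hasFDerivAt.comp x (ht.comp x hi)
    have h2 := h1.inner ℝ (h.hasFDerivAt_normal hx)
    have h3 : HasFDerivAt (fun y => ⟪U (tubeMap X ν (r, y)), ν y⟫_ℝ) (0 : E →L[ℝ] ℝ) x :=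
      (hasFDerivAt_const (0 : ℝ) x).congr_of_eventuallyEq htan
    have h4 := DFunLike.congr_fun (h2.unique h3) v
    simp [fderivInnerCLM_apply, hUc] at h4
    linarith
  -- The two shape operator terms cancel here, and the `ν`-part of `T c'` is orthogonal to `T (0,
  -- v)`.
  have key : ∀ v, ThinShell.deformation U (tubeMap X ν (r, x)) (ν x) (T (0, v)) =
      (1 / 2) * ⟪T (0, (deriv c r).2), T (0, v)⟫_ℝ := by
    intro v
    have hsplit : T (deriv c r) = (deriv c r).1 • ν x + T (0, (deriv c r).2) := by
      rw [hT0, hT, h.fderiv_tubeMap_apply hx]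
    have hcr : c r = (0, (c r).2) := Prod.ext hc1 rfl
    have hort : ⟪ν x, T (0, v)⟫_ℝ = 0 := h.inner_normal_fderiv_tubeMap hx r (0, v)
    have hs := hsymm (c r).2 v
    rw [← hcr] at hs
    rw [ThinShell.deformation, hdiff, hν, inner_add_left, ← hT, hsplit, inner_add_left,
      inner_smul_left, hort]
    have : (VectorField.pullback ℝ (tubeMap X ν) U (r, x)).2 = (c r).2 := rfl
    rw [this, hs, real_inner_comm (T (c r))]
    simp
  constructor
  · intro hS
    -- Testing with this vector makes the stress half its squared norm.
    have h1 := hS (T (0, (deriv c r).2))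
      (by rw [real_inner_comm]; exact h.inner_normal_fderiv_tubeMap hx r _)
    rw [key] at h1
    have h2 : T (0, (deriv c r).2) = 0 := by
      rw [← inner_self_eq_zero (𝕜 := ℝ)]; linarith
    have h3 := hinv.injective (h2.trans (map_zero T).symm)
    simpa using congrArg Prod.snd h3
  · intro h0 v hv
    obtain ⟨w, rfl⟩ := hinv.surjective v
    have hw : w.1 = 0 := by
      rw [← h.inner_normal_fderiv_tubeMap hx r w, real_inner_comm]; exact hv
    have hw' : w = (0, w.2) := Prod.ext hw rfl
    have h2 : T (0, (deriv c r).2) = 0 := by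
      rw [h0]; exact map_zero T
    rw [hw', key, h2, inner_zero_left, mul_zero]

end IsNormalParam

end NormalParam

/-! ### The Gauss and Weingarten formulas and the Ricci tensor in coordinates. -/

noncomputable section Coordinates

open Matrix ThinShell

variable {n : ℕ} {F : Type*} [NormedAddCommGroup F] [InnerProductSpace ℝ F]
  {X ν : EuclideanSpace ℝ (Fin n) → F} {s : Set (EuclideanSpace ℝ (Fin n))}
  {x : EuclideanSpace ℝ (Fin n)}

/-- The `i`-th coordinate vector of `ℝⁿ`. -/
abbrev coordVec (i : Fin n) : EuclideanSpace ℝ (Fin n) := EuclideanSpace.single i 1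

/-- The first fundamental form of the parametrization `X`. -/
def firstForm (X : EuclideanSpace ℝ (Fin n) → F) (x : EuclideanSpace ℝ (Fin n)) :
    Matrix (Fin n) (Fin n) ℝ :=
  Matrix.of fun i j => ⟪fderiv ℝ X x (coordVec i), fderiv ℝ X x (coordVec j)⟫_ℝ

/-- The second fundamental form of the parametrization `X` with unit normal `ν`. -/
def secondForm (X ν : EuclideanSpace ℝ (Fin n) → F) (x : EuclideanSpace ℝ (Fin n)) :
    Matrix (Fin n) (Fin n) ℝ :=
  Matrix.of fun i j => ⟪ν x, fderiv ℝ (fderiv ℝ X) x (coordVec i) (coordVec j)⟫_ℝ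

/-- The `i`-th tangential component of a vector in the frame `(ν, ∂₁X, …, ∂ₙX)` at `x`. -/
def tangComp (X ν : EuclideanSpace ℝ (Fin n) → F) (i : Fin n) (x : EuclideanSpace ℝ (Fin n)) :
    F →L[ℝ] ℝ :=
  (EuclideanSpace.proj i ∘L ContinuousLinearMap.snd ℝ ℝ (EuclideanSpace ℝ (Fin n))) ∘L
    (fderiv ℝ (tubeMap X ν) (0, x)).inverse

theorem sum_smul_coordVec (v : EuclideanSpace ℝ (Fin n)) : ∑ i, v i • coordVec i = v := by
  ext j
  simp [Pi.single_apply]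

theorem fderiv_fderiv_apply_eq {E G : Type*} [NormedAddCommGroup E] [NormedSpace ℝ E]
    [NormedAddCommGroup G] [NormedSpace ℝ G] {f : E → G} {y : E}
    (hf : DifferentiableAt ℝ (fderiv ℝ f) y) (v w : E) :
    fderiv ℝ (fun z => fderiv ℝ f z w) y v = fderiv ℝ (fderiv ℝ f) y v w := by
  rw [(hf.hasFDerivAt.clm_apply (hasFDerivAt_const w y)).fderiv]
  simp

namespace IsNormalParam

theorem isInvertible [FiniteDimensional ℝ F] (hd : Module.finrank ℝ F = n + 1)
    (h : IsNormalParam X ν s) (hx : x ∈ s) :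
    (fderiv ℝ (tubeMap X ν) (0, x)).IsInvertible :=
  h.isInvertible_fderiv_tubeMap hx (by simpa using hd)

theorem secondForm_eq (h : IsNormalParam X ν s) (hx : x ∈ s) (i j : Fin n) :
    secondForm X ν x i j = -⟪fderiv ℝ ν x (coordVec i), fderiv ℝ X x (coordVec j)⟫_ℝ :=
  h.inner_normal_fderiv_fderiv hx _ _

theorem secondForm_symm (h : IsNormalParam X ν s) (hx : x ∈ s) :
    (secondForm X ν x)ᵀ = secondForm X ν x := by
  ext i j
  simp only [secondForm, transpose_apply, of_apply]
  rw [h.fderiv_fderiv_symm hx]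

theorem partialDeriv_firstForm (h : IsNormalParam X ν s) (hx : x ∈ s) (i j k : Fin n) :
    partialDeriv i (fun y => firstForm X y j k) x =
      ⟪fderiv ℝ (fderiv ℝ X) x (coordVec i) (coordVec j), fderiv ℝ X x (coordVec k)⟫_ℝ +
      ⟪fderiv ℝ X x (coordVec j), fderiv ℝ (fderiv ℝ X) x (coordVec i) (coordVec k)⟫_ℝ := by
  have hd : HasFDerivAt (fderiv ℝ X) (fderiv ℝ (fderiv ℝ X) x) x :=
    ((h.contDiffAt_fderiv hx).differentiableAt (by simp)).hasFDerivAt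
  have h1 := (hd.clm_apply (hasFDerivAt_const (coordVec j) x)).inner ℝ
    (hd.clm_apply (hasFDerivAt_const (coordVec k) x))
  simp only [partialDeriv, firstForm, of_apply]
  rw [h1.fderiv]
  simp [fderivInnerCLM_apply]
  ring

section

variable [FiniteDimensional ℝ F] (hd : Module.finrank ℝ F = n + 1)
include hd

theorem tangComp_fderiv (h : IsNormalParam X ν s) (hx : x ∈ s) (i : Fin n)
    (v : EuclideanSpace ℝ (Fin n)) : tangComp X ν i x (fderiv ℝ X x v) = v i := by
  obtain ⟨e, he⟩ := h.isInvertible hd hx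
  have h1 : fderiv ℝ X x v = fderiv ℝ (tubeMap X ν) (0, x) (0, v) := by
    rw [h.fderiv_tubeMap_apply hx]; simp
  rw [h1]
  simp [tangComp, ← he]

theorem tangComp_normal (h : IsNormalParam X ν s) (hx : x ∈ s) (i : Fin n) :
    tangComp X ν i x (ν x) = 0 := by
  obtain ⟨e, he⟩ := h.isInvertible hd hx
  have h1 : ν x = fderiv ℝ (tubeMap X ν) (0, x) (1, 0) := by
    rw [h.fderiv_tubeMap_apply hx]; simp
  rw [h1]
  simp [tangComp, ← he]

theorem sum_tangComp_smul (h : IsNormalParam X ν s) (hx : x ∈ s) (w : F) :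
    ∑ i, tangComp X ν i x w • fderiv ℝ X x (coordVec i) + ⟪ν x, w⟫_ℝ • ν x = w := by
  obtain ⟨⟨a, v⟩, rfl⟩ := (h.isInvertible hd hx).surjective w
  rw [h.inner_normal_fderiv_tubeMap hx, h.fderiv_tubeMap_apply hx]
  simp only [map_add, map_smul, h.tangComp_normal hd hx, h.tangComp_fderiv hd hx, zero_smul,
    smul_zero, add_zero, zero_add]
  rw [add_comm]
  congr 1
  conv_rhs => rw [← sum_smul_coordVec v]
  simp

theorem inner_fderiv_eq_sum (h : IsNormalParam X ν s) (hx : x ∈ s) (w : F) (k : Fin n) :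
    ⟪w, fderiv ℝ X x (coordVec k)⟫_ℝ = ∑ i, tangComp X ν i x w * firstForm X x i k := by
  conv_lhs => rw [← h.sum_tangComp_smul hd hx w]
  rw [inner_add_left, sum_inner, inner_smul_left, h.orthogonal x hx]
  simp [inner_smul_left, firstForm]

omit [FiniteDimensional ℝ F] hd in
theorem firstForm_transpose : (firstForm X x)ᵀ = firstForm X x := by
  ext i j
  simp [firstForm, real_inner_comm]

omit [FiniteDimensional ℝ F] hd in
-- Gram matrix argument: if `z` is in the kernel, `dX z` is orthogonal to every `∂_i X`, hence to
-- itself.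
theorem isUnit_det_firstForm (h : IsNormalParam X ν s) (hx : x ∈ s) :
    IsUnit (firstForm X x).det := by
  rw [← Matrix.isUnit_iff_isUnit_det, ← Matrix.mulVec_injective_iff_isUnit]
  intro v w hvw
  have h0 : firstForm X x *ᵥ (v - w) = 0 := by rw [Matrix.mulVec_sub, hvw, sub_self]
  set z : EuclideanSpace ℝ (Fin n) := WithLp.toLp 2 (v - w) with hz
  have hX : ∀ i, ⟪fderiv ℝ X x (coordVec i), fderiv ℝ X x z⟫_ℝ = 0 := by
    intro i
    have := congrFun h0 i
    rw [← sum_smul_coordVec z]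
    simpa [Matrix.mulVec, dotProduct, firstForm, inner_sum, inner_smul_right, mul_comm, hz]
      using this
  have h1 : ⟪fderiv ℝ X x z, fderiv ℝ X x z⟫_ℝ = 0 := by
    nth_rewrite 1 [← sum_smul_coordVec z]
    simp only [map_sum, map_smul, sum_inner, inner_smul_left, hX]
    simp
  have h2 : z = 0 := h.injective x hx (by simpa using h1)
  exact sub_eq_zero.1 ((WithLp.toLp_eq_zero 2).1 h2)

theorem tangComp_eq_sum (h : IsNormalParam X ν s) (hx : x ∈ s) (i : Fin n) (w : F) :
    tangComp X ν i x w = ∑ k, (firstForm X x)⁻¹ i k * ⟪w, fderiv ℝ X x (coordVec k)⟫_ℝ := by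
  have h1 : (fun k => ⟪w, fderiv ℝ X x (coordVec k)⟫_ℝ) =
      firstForm X x *ᵥ fun j => tangComp X ν j x w := by
    ext k
    rw [h.inner_fderiv_eq_sum hd hx]
    refine Finset.sum_congr rfl fun l _ => ?_
    rw [mul_comm]
    exact congrArg (· * tangComp X ν l x w) (congrFun₂ (firstForm_transpose (X := X)) k l)
  have h2 := congrArg (fun z => ((firstForm X x)⁻¹ *ᵥ z) i) h1
  simp only [Matrix.mulVec_mulVec, Matrix.nonsing_inv_mul _ (h.isUnit_det_firstForm hx),
    Matrix.one_mulVec] at h2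
  rw [← h2]
  rfl

/-- The Gauss formula. -/
theorem christoffel_firstForm (h : IsNormalParam X ν s) (hx : x ∈ s) (l j k : Fin n) :
    christoffel (firstForm X) l j k x =
      tangComp X ν l x (fderiv ℝ (fderiv ℝ X) x (coordVec j) (coordVec k)) := by
  rw [christoffel, h.tangComp_eq_sum hd hx, Finset.mul_sum]
  refine Finset.sum_congr rfl fun m _ => ?_
  -- In the Koszul combination, symmetry of `D²X` cancels all terms except two copies of `⟪∂_j ∂_k
  -- X, ∂_m X⟫`.
  rw [h.partialDeriv_firstForm hx, h.partialDeriv_firstForm hx, h.partialDeriv_firstForm hx,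
    h.fderiv_fderiv_symm hx (coordVec m) (coordVec j),
    h.fderiv_fderiv_symm hx (coordVec m) (coordVec k),
    h.fderiv_fderiv_symm hx (coordVec k) (coordVec j),
    real_inner_comm (fderiv ℝ (fderiv ℝ X) x (coordVec k) (coordVec m)),
    real_inner_comm (fderiv ℝ (fderiv ℝ X) x (coordVec j) (coordVec m))]
  ring

/-- The Weingarten equations. -/
theorem tangComp_fderiv_normal (h : IsNormalParam X ν s) (hx : x ∈ s) (i j : Fin n) :
    tangComp X ν i x (fderiv ℝ ν x (coordVec j)) =
      -((firstForm X x)⁻¹ * secondForm X ν x) i j := by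
  rw [h.tangComp_eq_sum hd hx, Matrix.mul_apply, ← Finset.sum_neg_distrib]
  refine Finset.sum_congr rfl fun k _ => ?_
  rw [← h.secondForm_symm hx, transpose_apply, h.secondForm_eq hx]
  ring

theorem contDiffAt_tangComp (h : IsNormalParam X ν s) (hx : x ∈ s) (i : Fin n) :
    ContDiffAt ℝ ∞ (tangComp X ν i) x := by
  have h1 : ContDiffAt ℝ ∞ (fun y => (fderiv ℝ (tubeMap X ν) (0, y)).inverse) x :=
    (h.contDiffAt_inverse hx (h.isInvertible hd hx)).comp x (f := fun y => ((0 : ℝ), y))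
      (by fun_prop)
  exact contDiffAt_const.clm_comp h1

/-- Tangential components of the derivative of a vector field along a hypersurface. -/
theorem tangComp_fderiv_apply (h : IsNormalParam X ν s) (hx : x ∈ s)
    {w : EuclideanSpace ℝ (Fin n) → F} (hw : DifferentiableAt ℝ w x) (i j : Fin n) :
    tangComp X ν i x (fderiv ℝ w x (coordVec j)) =
      partialDeriv j (fun y => tangComp X ν i y (w y)) x
        + ∑ l, christoffel (firstForm X) i j l x * tangComp X ν l x (w x)
        - ⟪ν x, w x⟫_ℝ * ((firstForm X x)⁻¹ * secondForm X ν x) i j := by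
  have hP : HasFDerivAt (tangComp X ν i) _ x :=
    ((h.contDiffAt_tangComp hd hx i).differentiableAt (by simp)).hasFDerivAt
  have hprod : ∀ {f : EuclideanSpace ℝ (Fin n) → F}, DifferentiableAt ℝ f x →
      partialDeriv j (fun y => tangComp X ν i y (f y)) x =
        tangComp X ν i x (fderiv ℝ f x (coordVec j)) +
          fderiv ℝ (tangComp X ν i) x (coordVec j) (f x) := by
    intro f hf
    rw [partialDeriv, (hP.clm_apply hf.hasFDerivAt).fderiv]
    simp
  have hconst : ∀ {f : EuclideanSpace ℝ (Fin n) → ℝ} {a : ℝ}, (∀ y ∈ s, f y = a) →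
      partialDeriv j f x = 0 := by
    intro f a hf
    have : f =ᶠ[𝓝 x] fun _ => a := (h.eventually_mem hx).mono hf
    rw [partialDeriv, this.fderiv_eq]
    simp
  have hdX : DifferentiableAt ℝ (fderiv ℝ X) x :=
    (h.contDiffAt_fderiv hx).differentiableAt (by simp)
  -- The derivative of the projection is found on the frame: its values on `∂_l X` and on `ν` are
  -- constant along the surface, so the product rule gives zero there.
  have he : ∀ l, fderiv ℝ (tangComp X ν i) x (coordVec j) (fderiv ℝ X x (coordVec l)) =
      -christoffel (firstForm X) i j l x := by
    intro l
    have h1 := hprod (f := fun y => fderiv ℝ X y (coordVec l))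
      (hdX.clm_apply (differentiableAt_const _))
    rw [hconst (fun y hy => h.tangComp_fderiv hd hy i (coordVec l)),
      fderiv_fderiv_apply_eq hdX, ← h.christoffel_firstForm hd hx] at h1
    linarith
  have hn : fderiv ℝ (tangComp X ν i) x (coordVec j) (ν x) =
      ((firstForm X x)⁻¹ * secondForm X ν x) i j := by
    have h1 := hprod (h.hasFDerivAt_normal hx).differentiableAt
    rw [hconst (fun y hy => h.tangComp_normal hd hy i), h.tangComp_fderiv_normal hd hx] at h1
    linarith
  have h1 := hprod hw
  have h2 : fderiv ℝ (tangComp X ν i) x (coordVec j) (w x) =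
      -∑ l, christoffel (firstForm X) i j l x * tangComp X ν l x (w x) +
        ⟪ν x, w x⟫_ℝ * ((firstForm X x)⁻¹ * secondForm X ν x) i j := by
    conv_lhs => rw [← h.sum_tangComp_smul hd hx (w x)]
    simp only [map_add, map_sum, map_smul, he, hn, smul_eq_mul, mul_comm,
      ← Finset.sum_neg_distrib]
    simp only [neg_mul]
  rw [h1, h2]
  ring

/-- The Gauss equation. -/
theorem riemann_firstForm (h : IsNormalParam X ν s) (hx : x ∈ s) (l k i j : Fin n) :
    riemann (firstForm X) l k i j x =
      secondForm X ν x j k * ((firstForm X x)⁻¹ * secondForm X ν x) l i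
        - secondForm X ν x i k * ((firstForm X x)⁻¹ * secondForm X ν x) l j := by
  have hZ : ContDiffAt ℝ ∞ (fun z => fderiv ℝ X z (coordVec k)) x :=
    (h.contDiffAt_fderiv hx).clm_apply contDiffAt_const
  -- Viewing `∂_a ∂_k X` as a derivative of the single field `∂_k X` makes the third derivatives of
  -- `X` accessible to symmetry of second derivatives.
  have hdd : ∀ᶠ y in 𝓝 x, ∀ v, fderiv ℝ (fun z => fderiv ℝ X z (coordVec k)) y v =
      fderiv ℝ (fderiv ℝ X) y v (coordVec k) :=
    (h.eventually_mem hx).mono fun y hy v =>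
      fderiv_fderiv_apply_eq ((h.contDiffAt_fderiv hy).differentiableAt (by simp)) v _
  have hd3 : DifferentiableAt ℝ (fderiv ℝ (fun z => fderiv ℝ X z (coordVec k))) x :=
    (hZ.fderiv_right (m := ∞) (by simp)).differentiableAt (by simp)
  have hdiff : ∀ a, DifferentiableAt ℝ
      (fun y => fderiv ℝ (fderiv ℝ X) y (coordVec a) (coordVec k)) x := fun a =>
    (hd3.clm_apply (differentiableAt_const (coordVec a))).congr_of_eventuallyEq
      (hdd.mono fun y hy => (hy _).symm)
  have h3 : ∀ a b, fderiv ℝ (fun y => fderiv ℝ (fderiv ℝ X) y (coordVec a) (coordVec k)) x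
      (coordVec b) = fderiv ℝ (fderiv ℝ (fun z => fderiv ℝ X z (coordVec k))) x
        (coordVec b) (coordVec a) := by
    intro a b
    rw [← fderiv_fderiv_apply_eq hd3]
    have : (fun y => fderiv ℝ (fderiv ℝ X) y (coordVec a) (coordVec k)) =ᶠ[𝓝 x]
        fun y => fderiv ℝ (fun z => fderiv ℝ X z (coordVec k)) y (coordVec a) :=
      hdd.mono fun y hy => (hy _).symm
    rw [this.fderiv_eq]
  have hsymm : IsSymmSndFDerivAt ℝ (fun z => fderiv ℝ X z (coordVec k)) x :=
    hZ.isSymmSndFDerivAt (by simpa using WithTop.coe_le_coe.2 (le_top (a := (2 : ℕ∞))))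
  have hΓ : ∀ a b, partialDeriv b (christoffel (firstForm X) l a k) x =
      partialDeriv b (fun y => tangComp X ν l y
        (fderiv ℝ (fderiv ℝ X) y (coordVec a) (coordVec k))) x := by
    intro a b
    have : christoffel (firstForm X) l a k =ᶠ[𝓝 x] fun y => tangComp X ν l y
        (fderiv ℝ (fderiv ℝ X) y (coordVec a) (coordVec k)) :=
      (h.eventually_mem hx).mono fun y hy => h.christoffel_firstForm hd hy l a k
    rw [partialDeriv, this.fderiv_eq, partialDeriv]
  -- Both identities compute the tangential part of the same third derivative `∂_i ∂_j ∂_k X`; their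
  -- difference is the Gauss equation.
  have hi := h.tangComp_fderiv_apply hd hx (hdiff j) l i
  have hj := h.tangComp_fderiv_apply hd hx (hdiff i) l j
  rw [h3, ← hΓ] at hi hj
  rw [hsymm (coordVec j) (coordVec i)] at hj
  simp only [← h.christoffel_firstForm hd hx] at hi hj
  have hLj : ⟪ν x, fderiv ℝ (fderiv ℝ X) x (coordVec j) (coordVec k)⟫_ℝ =
    secondForm X ν x j k := rfl
  have hLi : ⟪ν x, fderiv ℝ (fderiv ℝ X) x (coordVec i) (coordVec k)⟫_ℝ =
    secondForm X ν x i k := rfl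
  rw [hLj] at hi
  rw [hLi] at hj
  rw [riemann, Finset.sum_sub_distrib]
  linarith

/-- The Ricci tensor in terms of the shape operator `S`: `Ric = (tr S) S - S²`. -/
theorem ricciEndo_firstForm (h : IsNormalParam X ν s) (hx : x ∈ s) (i l : Fin n) :
    ricciEndo (firstForm X) i l x =
      (((firstForm X x)⁻¹ * secondForm X ν x).trace • ((firstForm X x)⁻¹ * secondForm X ν x)
        - (firstForm X x)⁻¹ * secondForm X ν x * ((firstForm X x)⁻¹ * secondForm X ν x)) i l := by
  set G := (firstForm X x)⁻¹ with hG
  set K := secondForm X ν x with hK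
  have hGt : Gᵀ = G := by rw [hG, transpose_nonsing_inv, firstForm_transpose]
  have hKt : Kᵀ = K := h.secondForm_symm hx
  -- Contraction of the Gauss equation. Raising the index then uses `(G K)ᵀ = K G`.
  have h1 : ∀ j, ricci (firstForm X) j l x = ((G * K).trace • K - (G * K)ᵀ * K) j l := by
    intro j
    simp only [ricci, h.riemann_firstForm hd hx, Finset.sum_sub_distrib, Matrix.sub_apply, Matrix.smul_apply,
      smul_eq_mul, trace, diag_apply, mul_apply (M := (G * K)ᵀ), transpose_apply,
      ← Finset.mul_sum]
    congr 1
    · ring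
    · exact Finset.sum_congr rfl fun m _ => mul_comm _ _
  have h2 : ricciEndo (firstForm X) i l x = (G * ((G * K).trace • K - (G * K)ᵀ * K)) i l := by
    simp only [ricciEndo, h1, mul_apply (M := G) (N := _ - _)]
    rfl
  rw [h2, Matrix.mul_sub, Matrix.mul_smul, transpose_mul, hGt, hKt]
  simp only [Matrix.mul_assoc]

end

end IsNormalParam

end Coordinates

/-! ### The tangential part of the ambient Laplacian. -/

noncomputable section LaplacianInFermiCoordinates

open Matrix ThinShell

variable {n : ℕ} {F : Type*} [NormedAddCommGroup F] [InnerProductSpace ℝ F]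
  [FiniteDimensional ℝ F]
  {X ν : EuclideanSpace ℝ (Fin n) → F} {s : Set (EuclideanSpace ℝ (Fin n))}
  {x : EuclideanSpace ℝ (Fin n)}

namespace IsNormalParam

/-- The trace of a bilinear map in terms of the frame `(ν, ∂₁X, …, ∂ₙX)`. -/
theorem sum_orthonormalBasis_eq {κ G : Type*} [Fintype κ] [NormedAddCommGroup G] [NormedSpace ℝ G]
    (hd : Module.finrank ℝ F = n + 1) (h : IsNormalParam X ν s) (hx : x ∈ s)
    (b : OrthonormalBasis κ ℝ F) (T : F →L[ℝ] F →L[ℝ] G) :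
    ∑ a, T (b a) (b a) = T (ν x) (ν x) + ∑ j, ∑ k, (firstForm X x)⁻¹ j k •
      T (fderiv ℝ X x (coordVec j)) (fderiv ℝ X x (coordVec k)) := by
  have hGt : ∀ j k, (firstForm X x)⁻¹ j k = (firstForm X x)⁻¹ k j := fun j k => by
    rw [← transpose_apply (firstForm X x)⁻¹, transpose_nonsing_inv, firstForm_transpose]
  have hsum : ∀ w : F, ∑ a, ⟪b a, w⟫_ℝ • b a = w := fun w => b.sum_repr' w
  -- Only one slot is expanded in the frame. Summing its coefficients against the orthonormal basis
  -- in the other slot produces the dual frame `g^{jk} ∂_k X` and `ν`.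
  have h1 : ∀ a, T (b a) (b a) = ∑ j, T (tangComp X ν j x (b a) • b a) (fderiv ℝ X x (coordVec j))
      + T (⟪ν x, b a⟫_ℝ • b a) (ν x) := by
    intro a
    nth_rewrite 2 [← h.sum_tangComp_smul hd hx (b a)]
    simp [map_sum, map_add]
  have h2 : ∀ j, ∑ a, tangComp X ν j x (b a) • b a =
      ∑ k, (firstForm X x)⁻¹ j k • fderiv ℝ X x (coordVec k) := by
    intro j
    simp only [h.tangComp_eq_sum hd hx j, Finset.sum_smul, mul_smul]
    rw [Finset.sum_comm]
    simp only [← Finset.smul_sum, hsum]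
  have h3 : ∑ a, ⟪ν x, b a⟫_ℝ • b a = ν x := by
    simpa only [real_inner_comm] using hsum (ν x)
  simp only [h1, Finset.sum_add_distrib]
  rw [Finset.sum_comm, add_comm]
  congr 1
  · rw [← _root_.sum_apply, ← map_sum, h3]
  · simp only [← _root_.sum_apply, ← map_sum, h2]
    rw [Finset.sum_comm]
    simp only [map_sum, _root_.sum_apply, map_smul, _root_.smul_apply]
    refine Finset.sum_congr rfl fun j _ => Finset.sum_congr rfl fun k _ => ?_
    rw [hGt]

theorem laplacian_eq (hd : Module.finrank ℝ F = n + 1) (h : IsNormalParam X ν s) (hx : x ∈ s)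
    (U : F → F) (y : F) :
    Laplacian.laplacian U y = fderiv ℝ (fderiv ℝ U) y (ν x) (ν x) +
      ∑ j, ∑ k, (firstForm X x)⁻¹ j k • fderiv ℝ (fderiv ℝ U) y (fderiv ℝ X x (coordVec j))
        (fderiv ℝ X x (coordVec k)) := by
  rw [← h.sum_orthonormalBasis_eq hd hx (stdOrthonormalBasis ℝ F) (fderiv ℝ (fderiv ℝ U) y),
    InnerProductSpace.laplacian_eq_iteratedFDeriv_stdOrthonormalBasis]
  simp [iteratedFDeriv_two_apply]

/-- Only the first two normal derivatives at `r = 0` matter, so the same statement serves both a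
field with `∂_r U^i = 0` near `r = 0` and a thin-shell limit. -/
theorem tangComp_laplacian (hd : Module.finrank ℝ F = n + 1) (h : IsNormalParam X ν s)
    (hx : x ∈ s) {U : F → F} (hU : ContDiffAt ℝ 2 U (X x))
    (htan : ∀ᶠ y in 𝓝 x, ⟪ν y, U (X y)⟫_ℝ = 0)
    (h1 : (deriv (fun t => VectorField.pullback ℝ (tubeMap X ν) U (t, x)) 0).2 = 0)
    (h2 : (deriv (deriv fun t => VectorField.pullback ℝ (tubeMap X ν) U (t, x)) 0).2 = 0)
    (i : Fin n) :
    tangComp X ν i x (Laplacian.laplacian U (X x)) = deformationLaplacian (firstForm X)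
      (fun y => (VectorField.pullback ℝ (tubeMap X ν) U (0, y)).2) i x := by
  set u := fun y => (VectorField.pullback ℝ (tubeMap X ν) U (0, y)).2 with hudef
  have htube : ∀ y, tubeMap X ν (0, y) = X y := fun y => tubeMap_zero X ν y
  have hu : ∀ y l, u y l = tangComp X ν l y (U (X y)) := by
    intro y l
    rw [← htube y]
    rfl
  have hU0 : ContDiffAt ℝ 2 U (tubeMap X ν (0, x)) := by rwa [htube]
  have hinv := h.isInvertible hd hx
  have hU1 : DifferentiableAt ℝ U (X x) := hU.differentiableAt (by simp)
  -- normal derivatives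
  have hν : ∀ l, tangComp X ν l x (fderiv ℝ U (X x) (ν x)) =
      -∑ m, ((firstForm X x)⁻¹ * secondForm X ν x) l m * u x m := by
    intro l
    have h3 := h.fderiv_normal_eq hx hinv (hU0.differentiableAt (by simp))
    rw [htube] at h3
    have h4 : (VectorField.pullback ℝ (tubeMap X ν) U (0, x)).2 = u x := rfl
    rw [h3, h4, h.fderiv_tubeMap_apply hx, h1]
    simp only [map_zero, smul_zero, add_zero, map_add, map_smul, h.tangComp_normal hd hx,
      zero_add]
    conv_lhs => rw [← sum_smul_coordVec (u x)]
    simp only [map_sum, map_smul, h.tangComp_fderiv_normal hd hx, smul_eq_mul, mul_comm,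
      ← Finset.sum_neg_distrib]
    simp only [neg_mul]
  have hνν : tangComp X ν i x (fderiv ℝ (fderiv ℝ U) (X x) (ν x) (ν x)) = 0 := by
    have h3 := h.fderiv_fderiv_normal_eq hx hinv hU0
    rw [htube] at h3
    rw [h3, h.fderiv_tubeMap_apply hx, h1, h2]
    simp [h.tangComp_normal hd hx]
  -- tangential derivatives
  have hY : ContDiffAt ℝ 2 (fun y => U (X y)) x :=
    hU.comp x ((h.contDiffAt hx).of_le (WithTop.coe_le_coe.2 (le_top (a := (2 : ℕ∞)))))
  have hYd : ∀ᶠ y in 𝓝 x, DifferentiableAt ℝ (fun y => U (X y)) y :=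
    (hY.eventually (by simp)).mono fun y hy => hy.differentiableAt (by simp)
  have hY' : DifferentiableAt ℝ (fderiv ℝ fun y => U (X y)) x :=
    (hY.fderiv_right (m := 1) (by norm_num)).differentiableAt (by simp)
  have hcov : ∀ k l, covDeriv (firstForm X) u k l =ᶠ[𝓝 x] fun y =>
      tangComp X ν l y (fderiv ℝ (fun y => U (X y)) y (coordVec k)) := by
    intro k l
    filter_upwards [h.eventually_mem hx, hYd, htan] with y hy hyd hyt
    rw [h.tangComp_fderiv_apply hd hy hyd, hyt, zero_mul, sub_zero, covDeriv]
    simp only [hu]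
  -- Differentiated tangency: `⟪ν, ∂_k (U ∘ X)⟫ = -⟪∂_k ν, U⟫`.
  have hnormal : ∀ k, ⟪ν x, fderiv ℝ (fun y => U (X y)) x (coordVec k)⟫_ℝ =
      ∑ l, u x l * secondForm X ν x k l := by
    intro k
    have h3 := (h.hasFDerivAt_normal hx).inner ℝ hYd.self_of_nhds.hasFDerivAt
    have h4 : HasFDerivAt (fun y => ⟪ν y, U (X y)⟫_ℝ)
        (0 : EuclideanSpace ℝ (Fin n) →L[ℝ] ℝ) x :=
      (hasFDerivAt_const (0 : ℝ) x).congr_of_eventuallyEq htan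
    have h5 := DFunLike.congr_fun (h3.unique h4) (coordVec k)
    have h6 : ⟪fderiv ℝ ν x (coordVec k), U (X x)⟫_ℝ = -∑ l, u x l * secondForm X ν x k l := by
      conv_lhs => rw [← h.sum_tangComp_smul hd hx (U (X x)), htan.self_of_nhds]
      simp only [zero_smul, add_zero, inner_sum, inner_smul_right, h.secondForm_eq hx, hu,
        mul_neg, Finset.sum_neg_distrib, neg_neg]
    simp [fderivInnerCLM_apply] at h5
    linarith
  -- The normal part of `∂_k (U ∘ X)`, differentiated once more, is the source of the term `-S² u`.
  have hYY : ∀ j k, tangComp X ν i x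
      (fderiv ℝ (fderiv ℝ fun y => U (X y)) x (coordVec j) (coordVec k)) =
      partialDeriv j (covDeriv (firstForm X) u k i) x +
        ∑ l, christoffel (firstForm X) i j l x * covDeriv (firstForm X) u k l x -
        (∑ l, u x l * secondForm X ν x k l) * ((firstForm X x)⁻¹ * secondForm X ν x) i j := by
    intro j k
    rw [← fderiv_fderiv_apply_eq hY', h.tangComp_fderiv_apply hd hx
      (hY'.clm_apply (differentiableAt_const _)), hnormal]
    congr 2
    · exact congrArg (fun T : EuclideanSpace ℝ (Fin n) →L[ℝ] ℝ => T (coordVec j))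
        (hcov k i).fderiv_eq.symm
    · exact Finset.sum_congr rfl fun l _ => by rw [(hcov k l).eq_of_nhds]
  have hchain : ∀ j k, fderiv ℝ (fderiv ℝ fun y => U (X y)) x (coordVec j) (coordVec k) =
      fderiv ℝ (fderiv ℝ U) (X x) (fderiv ℝ X x (coordVec j)) (fderiv ℝ X x (coordVec k)) +
      fderiv ℝ U (X x) (fderiv ℝ (fderiv ℝ X) x (coordVec j) (coordVec k)) := by
    intro j k
    have hUe : ∀ᶠ y in 𝓝 x, DifferentiableAt ℝ U (X y) :=
      ((h.contDiffAt hx).continuousAt.eventually (hU.eventually (by simp))).mono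
        fun y hy => hy.differentiableAt (by simp)
    have h3 : (fun y => fderiv ℝ (fun y => U (X y)) y (coordVec k)) =ᶠ[𝓝 x]
        fun y => fderiv ℝ U (X y) (fderiv ℝ X y (coordVec k)) := by
      filter_upwards [h.eventually_mem hx, hUe] with y hy hyU
      have : HasFDerivAt (fun y => U (X y)) _ y := hyU.hasFDerivAt.comp y (h.hasFDerivAt hy)
      rw [this.fderiv]
      rfl
    have hUd : HasFDerivAt (fderiv ℝ U) (fderiv ℝ (fderiv ℝ U) (X x)) (X x) :=
      ((hU.fderiv_right (m := 1) (by norm_num)).differentiableAt (by simp)).hasFDerivAt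
    have hXd : HasFDerivAt (fderiv ℝ X) (fderiv ℝ (fderiv ℝ X) x) x :=
      ((h.contDiffAt_fderiv hx).differentiableAt (by simp)).hasFDerivAt
    have hUX : HasFDerivAt (fun y => fderiv ℝ U (X y)) _ x := hUd.comp x (h.hasFDerivAt hx)
    rw [← fderiv_fderiv_apply_eq hY', h3.fderiv_eq,
      (hUX.clm_apply (hXd.clm_apply (hasFDerivAt_const (coordVec k) x))).fderiv]
    simp [add_comm]
  -- The normal part `K_{jk} ν` of `∂_j ∂_k X` meets `∂_ν U`, whose tangential part is `-S u`; this
  -- is the source of `(tr S) S u`.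
  have hUXX : ∀ j k, tangComp X ν i x
      (fderiv ℝ U (X x) (fderiv ℝ (fderiv ℝ X) x (coordVec j) (coordVec k))) =
      ∑ l, christoffel (firstForm X) l j k x * covDeriv (firstForm X) u l i x
        - secondForm X ν x j k * ∑ m, ((firstForm X x)⁻¹ * secondForm X ν x) i m * u x m := by
    intro j k
    have h3 : ∀ l, tangComp X ν i x (fderiv ℝ U (X x) (fderiv ℝ X x (coordVec l))) =
        covDeriv (firstForm X) u l i x := by
      intro l
      rw [(hcov l i).eq_of_nhds]
      have : HasFDerivAt (fun y => U (X y)) _ x := hU1.hasFDerivAt.comp x (h.hasFDerivAt hx)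
      rw [this.fderiv]
      rfl
    have h4 : ⟪ν x, fderiv ℝ (fderiv ℝ X) x (coordVec j) (coordVec k)⟫_ℝ =
      secondForm X ν x j k := rfl
    conv_lhs => rw [← h.sum_tangComp_smul hd hx
      (fderiv ℝ (fderiv ℝ X) x (coordVec j) (coordVec k)), h4]
    simp only [map_add, map_sum, map_smul, h3, hν, smul_eq_mul, h.christoffel_firstForm hd hx]
    ring
  -- the shape operator terms
  have hmain : ∀ j k, tangComp X ν i x (fderiv ℝ (fderiv ℝ U) (X x) (fderiv ℝ X x (coordVec j))
      (fderiv ℝ X x (coordVec k))) = covDeriv₂ (firstForm X) u j k i x +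
      (secondForm X ν x j k * ∑ m, ((firstForm X x)⁻¹ * secondForm X ν x) i m * u x m -
      (∑ l, secondForm X ν x k l * u x l) * ((firstForm X x)⁻¹ * secondForm X ν x) i j) := by
    intro j k
    have h3 := congrArg (tangComp X ν i x) (hchain j k)
    rw [map_add, hYY, hUXX] at h3
    rw [covDeriv₂, Finset.sum_sub_distrib]
    simp only [mul_comm (secondForm X ν x k _)]
    linarith
  rw [h.laplacian_eq hd hx, map_add, hνν, zero_add]
  simp only [map_sum, map_smul, smul_eq_mul, hmain, mul_add, Finset.sum_add_distrib]
  rw [deformationLaplacian, bochnerLaplacian]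
  congr 1
  simp only [h.ricciEndo_firstForm hd hx]
  set G := (firstForm X x)⁻¹ with hG
  set K := secondForm X ν x with hK
  have hKt : Kᵀ = K := h.secondForm_symm hx
  have hl : ∀ (A : Matrix (Fin n) (Fin n) ℝ), ∑ l, A i l * u x l = (A *ᵥ u x) i := fun A => rfl
  have hl' : ∀ k, ∑ l, K k l * u x l = (K *ᵥ u x) k := fun k => rfl
  rw [hl, hl, sub_mulVec, smul_mulVec, ← Matrix.mulVec_mulVec, ← Matrix.mulVec_mulVec]
  simp only [hl', mul_sub, Finset.sum_sub_distrib]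
  rw [Pi.sub_apply, Pi.smul_apply, smul_eq_mul]
  congr 1
  · simp only [← mul_assoc, ← Finset.sum_mul]
    rw [Matrix.mulVec_mulVec]
    congr 1
    rw [trace]
    refine Finset.sum_congr rfl fun j _ => ?_
    rw [diag_apply, mul_apply]
    refine Finset.sum_congr rfl fun k _ => ?_
    rw [← hKt, transpose_apply, hKt]
  · have hu' : (G * K) *ᵥ (u x).ofLp = G *ᵥ (K *ᵥ (u x).ofLp) :=
      (Matrix.mulVec_mulVec _ _ _).symm
    rw [hu']
    change _ = ∑ j, (G * K) i j * ∑ k, G j k * (K *ᵥ (u x).ofLp) k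
    refine Finset.sum_congr rfl fun j _ => ?_
    rw [Finset.mul_sum]
    exact Finset.sum_congr rfl fun k _ => by ring

end IsNormalParam

end LaplacianInFermiCoordinates

/-! ### Limits over shrinking shells. -/

section ShellLimit

open ThinShell

theorem Filter.Tendsto.clm_apply {α E F : Type*} [NormedAddCommGroup E] [NormedSpace ℝ E]
    [NormedAddCommGroup F] [NormedSpace ℝ F] {l : Filter α} {f : α → E →L[ℝ] F} {f₀ : E →L[ℝ] F}
    {g : α → E} {g₀ : E} (hf : Tendsto f l (𝓝 f₀)) (hg : Tendsto g l (𝓝 g₀)) :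
    Tendsto (fun a => f a (g a)) l (𝓝 (f₀ g₀)) :=
  (isBoundedBilinearMap_apply.continuous.tendsto (f₀, g₀)).comp (hf.prodMk_nhds hg)

section Filter

variable {P : Type*} [TopologicalSpace P] {p : P}

theorem tendsto_snd_shellFilter (p : P) :
    Tendsto (fun q : ℝ × ℝ × P => q.2) (shellFilter p) (𝓝 (0, p)) := by
  rw [nhds_prod_eq]
  exact tendsto_snd.mono_left inf_le_left

theorem tendsto_map_shellFilter {Q : Type*} [TopologicalSpace Q] {f : P → Q}
    (hf : ContinuousAt f p) :
    Tendsto (fun q : ℝ × ℝ × P => (q.1, q.2.1, f q.2.2)) (shellFilter p) (shellFilter (f p)) := by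
  refine tendsto_inf.2 ⟨?_, ?_⟩
  · refine Tendsto.mono_left ?_ inf_le_left
    exact tendsto_fst.prodMk ((tendsto_fst.comp tendsto_snd).prodMk
      (hf.tendsto.comp (tendsto_snd.comp tendsto_snd)))
  · exact tendsto_principal.2 (mem_inf_of_right fun q hq => hq)

/-- Once `ε` is small, `|r| ≤ ε / 2` already forces `r` near `0`, so the property holds across the
whole thickness of the shell. -/
theorem eventually_of_shellFilter {R : ℝ × ℝ × P → Prop} (h : ∀ᶠ q in shellFilter p, R q) :
    ∀ᶠ ε in 𝓝[>] (0 : ℝ), ∀ᶠ y in 𝓝 p, ∀ r, |r| ≤ ε / 2 → R (ε, r, y) := by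
  rw [shellFilter, eventually_inf_principal] at h
  obtain ⟨pa, ha, pb, hb, hab⟩ := eventually_prod_iff.1 h
  obtain ⟨pc, hc, pd, hd, hcd⟩ := eventually_prod_iff.1 hb
  obtain ⟨δ, hδ, hball⟩ := Metric.eventually_nhds_iff.1 hc
  have hε : ∀ᶠ ε in 𝓝[>] (0 : ℝ), ε < δ := nhdsWithin_le_nhds (Iio_mem_nhds hδ)
  filter_upwards [ha, hε, self_mem_nhdsWithin] with ε hεa hεδ hε0
  filter_upwards [hd] with y hy r hr
  have hε0' : 0 < ε := hε0
  have hrδ : dist r 0 < δ := by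
    rw [Real.dist_eq, sub_zero]
    linarith
  exact hab hεa (hcd (hball hrδ) hy) hr

/-- A nonzero limit would keep `f` away from zero on the entire normal segment through `p` for small
`ε`. It therefore does not matter where on the segment the zero lies. -/
theorem eq_zero_of_tendsto_shellFilter {f : ℝ × ℝ × P → ℝ} {a : ℝ}
    (hf : Tendsto f (shellFilter p) (𝓝 a))
    (h : ∀ᶠ ε in 𝓝[>] (0 : ℝ), ∃ r, |r| ≤ ε / 2 ∧ f (ε, r, p) = 0) : a = 0 := by
  by_contra ha
  obtain ⟨ε, h1, r, hr, h2⟩ :=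
    ((eventually_of_shellFilter (hf.eventually_ne ha)).and h).exists
  exact h1.self_of_nhds r hr h2

end Filter

variable {E F : Type*} [NormedAddCommGroup E] [NormedSpace ℝ E] [FiniteDimensional ℝ E]
  [NormedAddCommGroup F] [InnerProductSpace ℝ F] [FiniteDimensional ℝ F]
  {X ν : E → F} {s : Set E} {x : E}

namespace IsNormalParam

/-- Solved for `c'`, the first-order identity is continuous in the jet of `U`, so convergence of
ambient derivatives carries over to Fermi components. The next lemma does the same for `c''`. -/
theorem deriv_pullback_eq (h : IsNormalParam X ν s) (hx : x ∈ s) {r : ℝ}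
    (hinv : (fderiv ℝ (tubeMap X ν) (r, x)).IsInvertible) {U : F → F}
    (hU : DifferentiableAt ℝ U (tubeMap X ν (r, x))) :
    deriv (fun t => VectorField.pullback ℝ (tubeMap X ν) U (t, x)) r =
      (fderiv ℝ (tubeMap X ν) (r, x)).inverse (fderiv ℝ U (tubeMap X ν (r, x)) (ν x) -
        fderiv ℝ ν x (VectorField.pullback ℝ (tubeMap X ν) U (r, x)).2) := by
  rw [h.fderiv_normal_eq hx hinv hU, add_sub_cancel_right]
  obtain ⟨e, he⟩ := hinv
  simp [← he]

theorem deriv_deriv_pullback_eq (h : IsNormalParam X ν s) (hx : x ∈ s) {r : ℝ}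
    (hinv : (fderiv ℝ (tubeMap X ν) (r, x)).IsInvertible) {U : F → F}
    (hU : ContDiffAt ℝ 2 U (tubeMap X ν (r, x))) :
    deriv (deriv fun t => VectorField.pullback ℝ (tubeMap X ν) U (t, x)) r =
      (fderiv ℝ (tubeMap X ν) (r, x)).inverse
        (fderiv ℝ (fderiv ℝ U) (tubeMap X ν (r, x)) (ν x) (ν x) - (2 : ℝ) • fderiv ℝ ν x
          (deriv (fun t => VectorField.pullback ℝ (tubeMap X ν) U (t, x)) r).2) := by
  rw [h.fderiv_fderiv_normal_eq hx hinv hU, add_sub_cancel_right]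
  obtain ⟨e, he⟩ := hinv
  simp [← he]

omit [FiniteDimensional ℝ F] in
theorem tendsto_inverse (h : IsNormalParam X ν s) (hx : x ∈ s)
    (hinv : (fderiv ℝ (tubeMap X ν) (0, x)).IsInvertible)
    {f : ℝ × ℝ × E → F} {a : F} (hf : Tendsto f (shellFilter x) (𝓝 a)) :
    Tendsto (fun q => (fderiv ℝ (tubeMap X ν) q.2).inverse (f q)) (shellFilter x)
      (𝓝 ((fderiv ℝ (tubeMap X ν) (0, x)).inverse a)) :=
  ((h.contDiffAt_inverse hx hinv).continuousAt.tendsto.comp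
    (tendsto_snd_shellFilter x)).clm_apply hf

variable {W : ℝ → F → F} {U : F → F}

/-- Convergence, together with two normal derivatives, of the Fermi components of a family of
vector fields on shrinking shells. -/
theorem tendsto_deriv_deriv_pullback (h : IsNormalParam X ν s) (hx : x ∈ s)
    (hinv : (fderiv ℝ (tubeMap X ν) (0, x)).IsInvertible)
    (hW : ∀ᶠ q in shellFilter x, ContDiffAt ℝ 2 (W q.1) (tubeMap X ν q.2))
    (hU : ContDiffAt ℝ 2 U (tubeMap X ν (0, x)))
    (hlim : ∀ k ≤ 2, Tendsto (fun q : ℝ × ℝ × E => iteratedFDeriv ℝ k (W q.1) (tubeMap X ν q.2))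
      (shellFilter x) (𝓝 (iteratedFDeriv ℝ k U (tubeMap X ν (0, x))))) :
    Tendsto (fun q : ℝ × ℝ × E =>
        deriv (fun t => VectorField.pullback ℝ (tubeMap X ν) (W q.1) (t, q.2.2)) q.2.1)
      (shellFilter x) (𝓝 (deriv (fun t => VectorField.pullback ℝ (tubeMap X ν) U (t, x)) 0)) ∧
    Tendsto (fun q : ℝ × ℝ × E =>
        deriv (deriv fun t => VectorField.pullback ℝ (tubeMap X ν) (W q.1) (t, q.2.2)) q.2.1)
      (shellFilter x)
      (𝓝 (deriv (deriv fun t => VectorField.pullback ℝ (tubeMap X ν) U (t, x)) 0)) := by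
  have hx2 : Tendsto (fun q : ℝ × ℝ × E => q.2.2) (shellFilter x) (𝓝 x) :=
    (continuous_snd.tendsto (0, x)).comp (tendsto_snd_shellFilter x)
  have hν : Tendsto (fun q : ℝ × ℝ × E => ν q.2.2) (shellFilter x) (𝓝 (ν x)) :=
    (h.contDiffAt_normal hx).continuousAt.tendsto.comp hx2
  have hdν : Tendsto (fun q : ℝ × ℝ × E => fderiv ℝ ν q.2.2) (shellFilter x)
      (𝓝 (fderiv ℝ ν x)) :=
    (h.contDiffAt_fderiv_normal hx).continuousAt.tendsto.comp hx2
  have hgood : ∀ᶠ q : ℝ × ℝ × E in shellFilter x, q.2.2 ∈ s ∧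
      (fderiv ℝ (tubeMap X ν) q.2).IsInvertible :=
    (hx2.eventually (h.eventually_mem hx)).and
      ((tendsto_snd_shellFilter x).eventually (h.eventually_isInvertible hx hinv))
  have h0 : Tendsto (fun q : ℝ × ℝ × E => W q.1 (tubeMap X ν q.2)) (shellFilter x)
      (𝓝 (U (tubeMap X ν (0, x)))) := by
    simpa using (hlim 0 (by norm_num)).eval (tendsto_const_nhds (x := (0 : Fin 0 → F)))
  have h1 : Tendsto (fun q : ℝ × ℝ × E => fderiv ℝ (W q.1) (tubeMap X ν q.2) (ν q.2.2))
      (shellFilter x) (𝓝 (fderiv ℝ U (tubeMap X ν (0, x)) (ν x))) := by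
    simpa [iteratedFDeriv_one_apply] using (hlim 1 (by norm_num)).eval
      (tendsto_pi_nhds.2 fun _ : Fin 1 => hν)
  have h2 : Tendsto (fun q : ℝ × ℝ × E =>
        fderiv ℝ (fderiv ℝ (W q.1)) (tubeMap X ν q.2) (ν q.2.2) (ν q.2.2))
      (shellFilter x) (𝓝 (fderiv ℝ (fderiv ℝ U) (tubeMap X ν (0, x)) (ν x) (ν x))) := by
    simpa [iteratedFDeriv_two_apply] using (hlim 2 le_rfl).eval
      (tendsto_pi_nhds.2 fun _ : Fin 2 => hν)
  have hc0 : Tendsto (fun q : ℝ × ℝ × E => VectorField.pullback ℝ (tubeMap X ν) (W q.1) q.2)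
      (shellFilter x) (𝓝 (VectorField.pullback ℝ (tubeMap X ν) U (0, x))) :=
    h.tendsto_inverse hx hinv h0
  have hc1 : Tendsto (fun q : ℝ × ℝ × E =>
        deriv (fun t => VectorField.pullback ℝ (tubeMap X ν) (W q.1) (t, q.2.2)) q.2.1)
      (shellFilter x)
      (𝓝 (deriv (fun t => VectorField.pullback ℝ (tubeMap X ν) U (t, x)) 0)) := by
    rw [h.deriv_pullback_eq hx hinv (hU.differentiableAt (by simp))]
    refine (h.tendsto_inverse hx hinv (h1.sub (hdν.clm_apply hc0.snd_nhds))).congr' ?_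
    filter_upwards [hgood, hW] with q hq hqW
    exact (h.deriv_pullback_eq hq.1 hq.2 (hqW.differentiableAt (by simp))).symm
  refine ⟨hc1, ?_⟩
  rw [h.deriv_deriv_pullback_eq hx hinv hU]
  refine (h.tendsto_inverse hx hinv
    (h2.sub ((hdν.clm_apply hc1.snd_nhds).const_smul (2 : ℝ)))).congr' ?_
  filter_upwards [hgood, hW] with q hq hqW
  exact (h.deriv_deriv_pullback_eq hq.1 hq.2 hqW).symm

theorem tendsto_pullback_laplacian (h : IsNormalParam X ν s) (hx : x ∈ s)
    (hinv : (fderiv ℝ (tubeMap X ν) (0, x)).IsInvertible)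
    (hlim : Tendsto (fun q : ℝ × ℝ × E => iteratedFDeriv ℝ 2 (W q.1) (tubeMap X ν q.2))
      (shellFilter x) (𝓝 (iteratedFDeriv ℝ 2 U (tubeMap X ν (0, x))))) :
    Tendsto (fun q : ℝ × ℝ × E =>
        VectorField.pullback ℝ (tubeMap X ν) (Laplacian.laplacian (W q.1)) q.2)
      (shellFilter x)
      (𝓝 (VectorField.pullback ℝ (tubeMap X ν) (Laplacian.laplacian U) (0, x))) := by
  refine h.tendsto_inverse hx hinv ?_
  simp only [InnerProductSpace.laplacian_eq_iteratedFDeriv_stdOrthonormalBasis]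
  exact tendsto_finsetSum _ fun i _ => hlim.eval tendsto_const_nhds

end IsNormalParam

variable {n : ℕ} {X ν : EuclideanSpace ℝ (Fin n) → F} {s : Set (EuclideanSpace ℝ (Fin n))}
  {x : EuclideanSpace ℝ (Fin n)} {W : ℝ → F → F} {U : F → F}

/-- The limit of fields that are tangential and stress-free on both walls of shrinking shells has
tangential components whose first two normal derivatives vanish. -/
theorem IsNormalParam.deriv_pullback_eq_zero_of_shell (h : IsNormalParam X ν s) (hx : x ∈ s)
    (hinv : (fderiv ℝ (tubeMap X ν) (0, x)).IsInvertible)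
    (hW : ∀ᶠ q in shellFilter x, ContDiffAt ℝ 2 (W q.1) (tubeMap X ν q.2))
    (hwall : ∀ᶠ q in shellFilter x, |q.2.1| = q.1 / 2 →
      TangentialAt (W q.1) (tubeMap X ν q.2) (ν q.2.2) ∧
      StressFreeAt (W q.1) (tubeMap X ν q.2) (ν q.2.2))
    (hU : ContDiffAt ℝ 2 U (tubeMap X ν (0, x)))
    (hlim : ∀ k ≤ 2, Tendsto
      (fun q : ℝ × ℝ × EuclideanSpace ℝ (Fin n) => iteratedFDeriv ℝ k (W q.1) (tubeMap X ν q.2))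
      (shellFilter x) (𝓝 (iteratedFDeriv ℝ k U (tubeMap X ν (0, x))))) :
    (deriv (fun t => VectorField.pullback ℝ (tubeMap X ν) U (t, x)) 0).2 = 0 ∧
      (deriv (deriv fun t => VectorField.pullback ℝ (tubeMap X ν) U (t, x)) 0).2 = 0 := by
  obtain ⟨h1, h2⟩ := h.tendsto_deriv_deriv_pullback hx hinv hW hU hlim
  have hsmooth : ∀ᶠ ε in 𝓝[>] (0 : ℝ), ∀ r, |r| ≤ ε / 2 →
      (fderiv ℝ (tubeMap X ν) (r, x)).IsInvertible ∧ ContDiffAt ℝ 2 (W ε) (tubeMap X ν (r, x)) :=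
    (eventually_of_shellFilter (((tendsto_snd_shellFilter x).eventually
      (h.eventually_isInvertible hx hinv)).and hW)).mono fun ε hε => hε.self_of_nhds
  have hzero : ∀ᶠ ε in 𝓝[>] (0 : ℝ), ∀ r, |r| = ε / 2 →
      (deriv (fun t => VectorField.pullback ℝ (tubeMap X ν) (W ε) (t, x)) r).2 = 0 := by
    filter_upwards [hsmooth, eventually_of_shellFilter hwall] with ε hε hw r hr
    obtain ⟨hi, hd⟩ := hε r hr.le
    refine (h.stressFreeAt_iff hx hi (hd.differentiableAt (by simp)) ?_).1
      (hw.self_of_nhds r hr.le hr).2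
    exact hw.mono fun y hy => (hy r hr.le hr).1
  constructor
  · ext i
    refine eq_zero_of_tendsto_shellFilter
      (((EuclideanSpace.proj i : _ →L[ℝ] ℝ).continuous.tendsto _).comp h1.snd_nhds) ?_
    filter_upwards [hzero, self_mem_nhdsWithin] with ε hε hpos
    have habs : |ε / 2| = ε / 2 := abs_of_pos (half_pos hpos)
    exact ⟨ε / 2, habs.le, by simp [hε (ε / 2) habs]⟩
  · ext i
    refine eq_zero_of_tendsto_shellFilter
      (((EuclideanSpace.proj i : _ →L[ℝ] ℝ).continuous.tendsto _).comp h2.snd_nhds) ?_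
    filter_upwards [hzero, hsmooth, self_mem_nhdsWithin] with ε hε hsm hpos
    have hpos' : 0 < ε := hpos
    set c' := deriv fun t => VectorField.pullback ℝ (tubeMap X ν) (W ε) (t, x) with hc'
    have hdiff : ∀ r, |r| ≤ ε / 2 → HasDerivAt (fun t => (c' t).2 i) ((deriv c' r).2 i) r := by
      intro r hr
      have h3 : DifferentiableAt ℝ c' r :=
        ((h.contDiffAt_pullback_line hx (hsm r hr).1 (hsm r hr).2).derivWithin (m := 1)
          (by norm_num)).differentiableAt (by simp)
      exact (EuclideanSpace.proj i : _ →L[ℝ] ℝ).hasFDerivAt.comp_hasDerivAt r h3.hasDerivAt.snd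
    -- Rolle's theorem between the two walls, one component at a time; the intermediate point may
    -- depend on `i`.
    obtain ⟨r, hr, hr0⟩ := exists_hasDerivAt_eq_zero (f := fun t => (c' t).2 i)
      (f' := fun t => (deriv c' t).2 i) (a := -(ε / 2)) (b := ε / 2) (by linarith)
      (fun t ht => (hdiff t (abs_le.2 ht)).continuousAt.continuousWithinAt)
      (by
        have habs : |ε / 2| = ε / 2 := abs_of_pos (half_pos hpos)
        simp only
        rw [hε (ε / 2) habs, hε (-(ε / 2)) (by rw [abs_neg, habs])])
      (fun t ht => hdiff t (abs_le.2 ⟨ht.1.le, ht.2.le⟩))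
    exact ⟨r, abs_le.2 ⟨hr.1.le, hr.2.le⟩, hr0⟩

end ShellLimit

/-! ### From an embedded manifold to local parametrizations. -/

section Manifold

open ThinShell IsManifold

/-- An immersion is injective on tangent vectors, in every chart. -/
theorem injective_fderiv_comp_symm {n m : ℕ} {M : Type*} [TopologicalSpace M]
    [ChartedSpace (EuclideanSpace ℝ (Fin n)) M] [IsManifold (𝓡 n) ∞ M]
    {ι : M → EuclideanSpace ℝ (Fin m)} (hι : IsImmersion (𝓡 n) (𝓡 m) ∞ ι)
    {φ : OpenPartialHomeomorph M (EuclideanSpace ℝ (Fin n))}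
    (hφ : φ ∈ maximalAtlas (𝓡 n) ∞ M) {x : EuclideanSpace ℝ (Fin n)} (hx : x ∈ φ.target) :
    Function.Injective (fderiv ℝ (fun y => ι (φ.symm y)) x) := by
  have him := hι.isImmersionAt (φ.symm x)
  set ψ := him.domChart with hψ
  set χ := him.codChart with hχ
  have hψs : φ.symm x ∈ ψ.source := him.mem_domChart_source
  have hχs : ι (φ.symm x) ∈ χ.source := him.mem_codChart_source
  set L : EuclideanSpace ℝ (Fin m) →L[ℝ] EuclideanSpace ℝ (Fin n) :=
    ContinuousLinearMap.fst ℝ _ _ ∘L him.equiv.symm.toContinuousLinearMap with hL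
  -- In immersion charts `ι` is the inclusion `z ↦ (z, 0)`, so the projection `L` recovers the chart
  -- `ψ`.
  have hloc : ∀ p ∈ ψ.source, L (χ (ι p)) = ψ p := by
    intro p hp
    have hp' : ψ p ∈ (him.domChart.extend (𝓡 n)).target := by
      simpa [← hψ] using ψ.map_source hp
    have h1 := him.writtenInCharts hp'
    have h2 : χ (ι p) = him.equiv (ψ p, 0) := by simpa [← hψ, ← hχ, ψ.left_inv hp] using h1
    simp [hL, h2]
  have hsymm : ContinuousAt φ.symm x := φ.continuousAt_symm hx
  have hleft : (fun y => L (χ (ι (φ.symm y)))) =ᶠ[𝓝 x] fun y => ψ (φ.symm y) :=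
    (hsymm.eventually (ψ.open_source.mem_nhds hψs)).mono fun y hy => hloc _ hy
  have hφd : ContMDiffAt (𝓡 n) (𝓡 n) ∞ φ.symm x :=
    contMDiffOn_symm_of_mem_maximalAtlas hφ |>.contMDiffAt (φ.open_target.mem_nhds hx)
  have hX : DifferentiableAt ℝ (fun y => ι (φ.symm y)) x :=
    (contMDiffAt_iff_contDiffAt.1 (hι.contMDiff.contMDiffAt.comp x hφd)).differentiableAt (by simp)
  have hχd : DifferentiableAt ℝ χ (ι (φ.symm x)) :=
    (contMDiffAt_iff_contDiffAt.1 (contMDiffAt_of_mem_maximalAtlas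
      him.codChart_mem_maximalAtlas hχs)).differentiableAt (by simp)
  have hψd : DifferentiableAt ℝ (fun y => ψ (φ.symm y)) x :=
    (contMDiffAt_iff_contDiffAt.1 ((contMDiffAt_of_mem_maximalAtlas
      him.domChart_mem_maximalAtlas hψs).comp x hφd)).differentiableAt (by simp)
  have hφx : φ (φ.symm x) = x := φ.right_inv hx
  have hinvd : DifferentiableAt ℝ (fun z => φ (ψ.symm z)) (ψ (φ.symm x)) := by
    have h1 : ContMDiffAt (𝓡 n) (𝓡 n) ∞ ψ.symm (ψ (φ.symm x)) :=
      contMDiffOn_symm_of_mem_maximalAtlas him.domChart_mem_maximalAtlas |>.contMDiffAt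
        (ψ.open_target.mem_nhds (ψ.map_source hψs))
    have h2 : ContMDiffAt (𝓡 n) (𝓡 n) ∞ φ (ψ.symm (ψ (φ.symm x))) := by
      rw [ψ.left_inv hψs]
      exact contMDiffAt_of_mem_maximalAtlas hφ (φ.map_target hx)
    exact (contMDiffAt_iff_contDiffAt.1 (h2.comp _ h1)).differentiableAt (by simp)
  have hid : (fun y => φ (ψ.symm (ψ (φ.symm y)))) =ᶠ[𝓝 x] id := by
    filter_upwards [hsymm.eventually (ψ.open_source.mem_nhds hψs),
      φ.open_target.mem_nhds hx] with y hy hyt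
    rw [ψ.left_inv hy, φ.right_inv hyt, id]
  have h3 : HasFDerivAt (fun y => L (χ (ι (φ.symm y)))) _ x :=
    L.hasFDerivAt.comp x (hχd.hasFDerivAt.comp x hX.hasFDerivAt)
  have h4 := (h3.congr_of_eventuallyEq hleft.symm).unique hψd.hasFDerivAt
  have h5 : HasFDerivAt (fun y => φ (ψ.symm (ψ (φ.symm y)))) _ x :=
    HasFDerivAt.comp (g := fun z => φ (ψ.symm z)) x hinvd.hasFDerivAt hψd.hasFDerivAt
  have h6 := h5.unique ((hasFDerivAt_id x).congr_of_eventuallyEq hid)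
  -- The derivative of `φ ∘ ψ⁻¹` composed with `L ∘ Dχ` is a left inverse of the derivative of `ι ∘
  -- φ⁻¹`.
  intro v w hvw
  have hv := DFunLike.congr_fun h6 v
  have hw := DFunLike.congr_fun h6 w
  rw [← h4] at hv hw
  simp only [ContinuousLinearMap.comp_apply] at hv hw
  rw [hvw] at hv
  exact hv.symm.trans hw

theorem isNormalParam_chart {n : ℕ} {M : Type*} [TopologicalSpace M]
    [ChartedSpace (EuclideanSpace ℝ (Fin n)) M] [IsManifold (𝓡 n) ∞ M]
    {ι N : M → EuclideanSpace ℝ (Fin (n + 1))} (hι : IsImmersion (𝓡 n) (𝓡 (n + 1)) ∞ ι)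
    (hN : IsUnitNormal ι N) {φ : OpenPartialHomeomorph M (EuclideanSpace ℝ (Fin n))}
    (hφ : φ ∈ maximalAtlas (𝓡 n) ∞ M) :
    IsNormalParam (fun y => ι (φ.symm y)) (fun y => N (φ.symm y)) φ.target where
  isOpen := φ.open_target
  contDiffOn := contMDiffOn_iff_contDiffOn.1
    (hι.contMDiff.comp_contMDiffOn (contMDiffOn_symm_of_mem_maximalAtlas hφ))
  contDiffOn_normal := contMDiffOn_iff_contDiffOn.1
    (hN.smooth.comp_contMDiffOn (contMDiffOn_symm_of_mem_maximalAtlas hφ))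
  norm_normal _ _ := hN.norm_eq_one _
  orthogonal x hx v := by
    have h1 : MDifferentiableAt (𝓡 n) (𝓡 n) φ.symm x :=
      (contMDiffOn_symm_of_mem_maximalAtlas hφ |>.contMDiffAt
        (φ.open_target.mem_nhds hx)).mdifferentiableAt (by simp)
    have h2 : MDifferentiableAt (𝓡 n) (𝓡 (n + 1)) ι (φ.symm x) :=
      hι.contMDiff.mdifferentiableAt (by simp)
    have h3 := mfderiv_comp x h2 h1
    rw [mfderiv_eq_fderiv] at h3
    have h4 := hN.orthogonal (φ.symm x) (mfderiv (𝓡 n) (𝓡 n) φ.symm x v)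
    have h5 := DFunLike.congr_fun h3 v
    rw [← h4]
    exact congrArg (fun z => ⟪N (φ.symm x), z⟫_ℝ) h5
  injective _ hx := injective_fderiv_comp_symm hι hφ hx

end Manifold


/-! ### The three statements in a chart of the hypersurface. -/

theorem theorem1 {n : ℕ} {M : Type*} [TopologicalSpace M]
    [ChartedSpace (EuclideanSpace ℝ (Fin n)) M] [IsManifold (𝓡 n) ∞ M]
    (ι : M → EuclideanSpace ℝ (Fin (n + 1)))
    (hι : IsSmoothEmbedding (𝓡 n) (𝓡 (n + 1)) ∞ ι)
    (N : M → EuclideanSpace ℝ (Fin (n + 1))) (hN : ThinShell.IsUnitNormal ι N)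
    (φ : OpenPartialHomeomorph M (EuclideanSpace ℝ (Fin n)))
    (hφ : φ ∈ IsManifold.maximalAtlas (𝓡 n) ∞ M) :
    -- for fields tangential to `M`, the Navier-slip condition on `M` reads `∂_r U^i = 0`
    (∀ U : EuclideanSpace ℝ (Fin (n + 1)) → EuclideanSpace ℝ (Fin (n + 1)),
      (∀ p, DifferentiableAt ℝ U (ι p)) →
      (∀ p, ThinShell.TangentialAt U (ι p) (N p)) →
      ∀ x ∈ φ.target,
        (ThinShell.StressFreeAt U (ι (φ.symm x)) (N (φ.symm x)) ↔
          ∀ i, deriv (fun r => ThinShell.fermiComp ι N φ U r x i) 0 = 0)) ∧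
    -- if `∂_r U^i = 0` holds in the normal direction, the tangential part of the ambient
    -- Bochner Laplacian on `M` is the deformation Laplacian
    (∀ U : EuclideanSpace ℝ (Fin (n + 1)) → EuclideanSpace ℝ (Fin (n + 1)),
      (∀ p, ContDiffAt ℝ 2 U (ι p)) →
      (∀ p, ThinShell.TangentialAt U (ι p) (N p)) →
      ∀ x ∈ φ.target,
        (∀ᶠ r in 𝓝 (0 : ℝ), ∀ i, deriv (fun s => ThinShell.fermiComp ι N φ U s x i) r = 0) →
        ∀ i, ThinShell.fermiComp ι N φ (Laplacian.laplacian U) 0 x i =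
          ThinShell.deformationLaplacian (ThinShell.inducedMetric ι φ)
            (ThinShell.fermiComp ι N φ U 0) i x) ∧
    -- thin-shell limit: fields `W ε` on the shells `|r| ≤ ε / 2`, tangential and stress-free on
    -- both walls `r = ± ε / 2`, converging in `C²` to a field `U`
    (∀ (W : ℝ → EuclideanSpace ℝ (Fin (n + 1)) → EuclideanSpace ℝ (Fin (n + 1)))
      (U : EuclideanSpace ℝ (Fin (n + 1)) → EuclideanSpace ℝ (Fin (n + 1))),
      (∀ p, ∀ᶠ q in ThinShell.shellFilter p,
        ContDiffAt ℝ 2 (W q.1) (ThinShell.normalShift ι N q.2.1 q.2.2)) →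
      (∀ p, ∀ᶠ q in ThinShell.shellFilter p, |q.2.1| = q.1 / 2 →
        ThinShell.TangentialAt (W q.1) (ThinShell.normalShift ι N q.2.1 q.2.2) (N q.2.2) ∧
        ThinShell.StressFreeAt (W q.1) (ThinShell.normalShift ι N q.2.1 q.2.2) (N q.2.2)) →
      (∀ p, ContDiffAt ℝ 2 U (ι p)) →
      (∀ p, ∀ k ≤ 2, Tendsto
        (fun q : ℝ × ℝ × M =>
          iteratedFDeriv ℝ k (W q.1) (ThinShell.normalShift ι N q.2.1 q.2.2))
        (ThinShell.shellFilter p) (𝓝 (iteratedFDeriv ℝ k U (ι p)))) →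
      (∀ p, ThinShell.TangentialAt U (ι p) (N p)) ∧
      ∀ x ∈ φ.target, ∀ i, Tendsto
        (fun q : ℝ × ℝ × EuclideanSpace ℝ (Fin n) =>
          ThinShell.fermiComp ι N φ (Laplacian.laplacian (W q.1)) q.2.1 q.2.2 i)
        (ThinShell.shellFilter x)
        (𝓝 (ThinShell.deformationLaplacian (ThinShell.inducedMetric ι φ)
          (ThinShell.fermiComp ι N φ U 0) i x))) := by
  set X : EuclideanSpace ℝ (Fin n) → EuclideanSpace ℝ (Fin (n + 1)) := fun y => ι (φ.symm y)
  set ν : EuclideanSpace ℝ (Fin n) → EuclideanSpace ℝ (Fin (n + 1)) := fun y => N (φ.symm y)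
  have h : IsNormalParam X ν φ.target := isNormalParam_chart hι.isImmersion hN hφ
  have hd : Module.finrank ℝ (EuclideanSpace ℝ (Fin (n + 1))) = n + 1 := by simp
  have htube : ∀ y, tubeMap X ν (0, y) = ι (φ.symm y) := fun y => tubeMap_zero X ν y
  have hcomp : ∀ {U : EuclideanSpace ℝ (Fin (n + 1)) → EuclideanSpace ℝ (Fin (n + 1))}
      {r : ℝ} {x : EuclideanSpace ℝ (Fin n)} (i : Fin n),
      DifferentiableAt ℝ (fun t => VectorField.pullback ℝ (tubeMap X ν) U (t, x)) r →
      deriv (fun t => ThinShell.fermiComp ι N φ U t x i) r =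
        (deriv (fun t => VectorField.pullback ℝ (tubeMap X ν) U (t, x)) r).2 i :=
    fun i hc => ((EuclideanSpace.proj i : _ →L[ℝ] ℝ).hasFDerivAt.comp_hasDerivAt _
      hc.hasDerivAt.snd).deriv
  have hlap : ∀ U : EuclideanSpace ℝ (Fin (n + 1)) → EuclideanSpace ℝ (Fin (n + 1)),
      (∀ p, ContDiffAt ℝ 2 U (ι p)) → (∀ p, ThinShell.TangentialAt U (ι p) (N p)) →
      ∀ x ∈ φ.target,
      (deriv (fun t => VectorField.pullback ℝ (tubeMap X ν) U (t, x)) 0).2 = 0 →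
      (deriv (deriv fun t => VectorField.pullback ℝ (tubeMap X ν) U (t, x)) 0).2 = 0 →
      ∀ i, ThinShell.fermiComp ι N φ (Laplacian.laplacian U) 0 x i =
        ThinShell.deformationLaplacian (ThinShell.inducedMetric ι φ)
          (ThinShell.fermiComp ι N φ U 0) i x := by
    intro U hU htan x hx h1 h2 i
    have h3 := h.tangComp_laplacian hd hx (hU (φ.symm x))
      (Eventually.of_forall fun y => (real_inner_comm _ _).trans (htan (φ.symm y))) h1 h2 i
    rw [show X x = tubeMap X ν (0, x) from (htube x).symm] at h3
    exact h3
  refine ⟨?_, ?_, ?_⟩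
  · intro U hU htan x hx
    have hinv := h.isInvertible hd hx
    have hU' : DifferentiableAt ℝ U (tubeMap X ν (0, x)) := by rw [htube]; exact hU _
    have h1 := h.stressFreeAt_iff hx hinv hU' (Eventually.of_forall fun y => by
      rw [htube]; exact htan _)
    rw [htube] at h1
    refine h1.trans ⟨fun h2 i => ?_, fun h2 => ?_⟩
    · rw [hcomp i (h.differentiableAt_pullback_line hx hinv hU'), h2]
      rfl
    · ext i
      rw [← hcomp i (h.differentiableAt_pullback_line hx hinv hU'), h2]
      rfl
  · intro U hU htan x hx hr
    have hinv := h.isInvertible hd hx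
    have hU' : ContDiffAt ℝ 2 U (tubeMap X ν (0, x)) := by rw [htube]; exact hU _
    have hc : ContDiffAt ℝ 2 (fun t => VectorField.pullback ℝ (tubeMap X ν) U (t, x)) 0 :=
      h.contDiffAt_pullback_line hx hinv hU'
    have h1 : ∀ᶠ r in 𝓝 (0 : ℝ),
        (deriv (fun t => VectorField.pullback ℝ (tubeMap X ν) U (t, x)) r).2 = 0 := by
      filter_upwards [hr, hc.eventually (by simp)] with r h0 hcr
      ext i
      rw [← hcomp i (hcr.differentiableAt (by simp)), h0]
      rfl
    have hc' : DifferentiableAt ℝ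
        (deriv fun t => VectorField.pullback ℝ (tubeMap X ν) U (t, x)) 0 :=
      (hc.derivWithin (m := 1) (by norm_num)).differentiableAt (by simp)
    -- The first normal derivative vanishes for all `r` near `0`, hence so does the second at `r =
    -- 0`.
    have h2 : HasDerivAt
        (fun r => (deriv (fun t => VectorField.pullback ℝ (tubeMap X ν) U (t, x)) r).2) 0 0 :=
      (hasDerivAt_const (0 : ℝ) (0 : EuclideanSpace ℝ (Fin n))).congr_of_eventuallyEq h1
    have h3 : HasDerivAt
        (fun r => (deriv (fun t => VectorField.pullback ℝ (tubeMap X ν) U (t, x)) r).2)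
        (deriv (deriv fun t => VectorField.pullback ℝ (tubeMap X ν) U (t, x)) 0).2 0 :=
      hc'.hasDerivAt.snd
    exact hlap U hU htan x hx h1.self_of_nhds (h3.unique h2)
  · intro W U hW hwall hU hlim
    have htan : ∀ p, ThinShell.TangentialAt U (ι p) (N p) := by
      intro p
      have hN' : Tendsto (fun q : ℝ × ℝ × M => N q.2.2) (ThinShell.shellFilter p) (𝓝 (N p)) :=
        (hN.smooth.continuous.tendsto p).comp
          ((continuous_snd.tendsto (0, p)).comp (tendsto_snd_shellFilter p))
      have hW0 : Tendsto (fun q : ℝ × ℝ × M =>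
          W q.1 (ThinShell.normalShift ι N q.2.1 q.2.2)) (ThinShell.shellFilter p)
          (𝓝 (U (ι p))) := by
        simpa using (hlim p 0 (by norm_num)).eval
          (tendsto_const_nhds (x := (0 : Fin 0 → EuclideanSpace ℝ (Fin (n + 1)))))
      -- Tangency of the limit is inherited from the single wall `r = ε / 2`.
      refine eq_zero_of_tendsto_shellFilter (hW0.inner hN') ?_
      filter_upwards [eventually_of_shellFilter (hwall p), self_mem_nhdsWithin] with ε hε hpos
      have habs : |ε / 2| = ε / 2 := abs_of_pos (half_pos hpos)
      exact ⟨ε / 2, habs.le, (hε.self_of_nhds _ habs.le habs).1⟩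
    refine ⟨htan, fun x hx i => ?_⟩
    have hinv := h.isInvertible hd hx
    have hmap := tendsto_map_shellFilter (φ.continuousAt_symm hx)
    have hU' : ContDiffAt ℝ 2 U (tubeMap X ν (0, x)) := by rw [htube]; exact hU _
    have hlim' : ∀ k ≤ 2, Tendsto (fun q : ℝ × ℝ × EuclideanSpace ℝ (Fin n) =>
        iteratedFDeriv ℝ k (W q.1) (tubeMap X ν q.2))
        (ThinShell.shellFilter x) (𝓝 (iteratedFDeriv ℝ k U (tubeMap X ν (0, x)))) := by
      intro k hk
      rw [htube]
      exact (hlim (φ.symm x) k hk).comp hmap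
    obtain ⟨h1, h2⟩ := h.deriv_pullback_eq_zero_of_shell hx hinv
      (hmap.eventually (hW (φ.symm x))) (hmap.eventually (hwall (φ.symm x))) hU' hlim'
    -- The target becomes the Fermi component of the ambient Laplacian of `U`, to which those of `W
    -- ε` converge by convergence of second derivatives.
    rw [← hlap U hU htan x hx h1 h2 i]
    exact ((EuclideanSpace.proj i : _ →L[ℝ] ℝ).continuous.tendsto _).comp
      (h.tendsto_pullback_laplacian hx hinv (hlim' 2 le_rfl)).snd_nhds
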